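/- There is an absolute constant $c>0$ such that the following holds for every integer $r\ge 1$, every finite connected graph $G=(V,E)$ with nonnegative edge weights that has no $K_r$ minor, and every $\varepsilon\in(0,1)$. Let $\delta_G(u,v)$ denote the weighted shortest-path distance and let $\mathrm{diam}(G)=\max_{u,v\in V}\delta_G(u,v)$. Put $h=2^{c\,r\log r}/\varepsilon$. Then $G$ admits an $(\varepsilon,h)$-shortcut partition, that is, a partition $\mathcal C$ of $V$ into clusters, each inducing a connected subgraph of $G$, such that: (Diameter) for every cluster $C\in\mathcal C$, the strong diameter of $C$, i.e. the (weighted) diameter of the induced subgraph $G[C]$, is at most $\varepsilon\cdot\mathrm{diam}(G)$; (Low-hop) for all $u,v\in V$ and every given shortest path $P$ in $G$ between $u$ and $v$, there is a path $\check\pi$ in the cluster graph, from the cluster containing $u$ to the cluster containing $v$, that has at most $\varepsilon h\cdot\left\lceil \delta_G(u,v)/(\varepsilon\,\mathrm{diam}(G))\right\rceil$ edges and visits only clusters that intersect $P$. Here the cluster graph has the clusters as its vertices, and two distinct clusters are adjacent if $G$ has an edge with one endpoint in each. If $\mathrm{diam}(G)=0$, the quotient $\delta_G(u,v)/(\varepsilon\,\mathrm{diam}(G))$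 is read as $0$. -/

import Mathlib

noncomputable section

namespace ShortcutPartition

variable {V W : Type*}

/-- `H` is a minor of `G`: there are pairwise disjoint connected (in particular nonempty) branch
sets in `G`, one for every vertex of `H`, such that `G` has an edge between the branch sets of any
two adjacent vertices of `H`. -/
def IsMinor (H : SimpleGraph W) (G : SimpleGraph V) : Prop :=
  ∃ B : W → Set V,
    (∀ i, (G.induce (B i)).Connected) ∧
    (∀ i j, i ≠ j → Disjoint (B i) (B j)) ∧
    ∀ i j, H.Adj i j → ∃ x ∈ B i, ∃ y ∈ B j, G.Adj x y

/-- `G` has no minor isomorphic to the complete graph on `r` vertices. -/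
def CliqueMinorFree (r : ℕ) (G : SimpleGraph V) : Prop :=
  ¬ IsMinor (⊤ : SimpleGraph (Fin r)) G

/-- The length of a walk: the sum of the weights of its edges. -/
def wlen {G : SimpleGraph V} (w : Sym2 V → ℝ) {u v : V} (p : G.Walk u v) : ℝ :=
  (p.edges.map w).sum

/-- The distance in the graph `G` with edge weights `w`: the least length of a walk.
(Used for connected graphs with nonnegative weights only.) -/
def wdist (G : SimpleGraph V) (w : Sym2 V → ℝ) (u v : V) : ℝ :=
  ⨅ p : G.Walk u v, wlen w p

/-- The diameter of the graph `G` with edge weights `w`: the largest distance of two vertices.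
(Used for finite connected graphs only.) -/
def wdiam (G : SimpleGraph V) (w : Sym2 V → ℝ) : ℝ :=
  ⨆ q : V × V, wdist G w q.1 q.2

/-- The strong diameter of a set `C` of vertices: the diameter of the induced subgraph `G[C]`. -/
def strongDiam (G : SimpleGraph V) (w : Sym2 V → ℝ) (C : Set V) : ℝ :=
  wdiam (G.induce C) (fun e => w (e.map Subtype.val))

/-- `p` is a shortest path of `G` between `u` and `v`. -/
def IsShortestPath {G : SimpleGraph V} (w : Sym2 V → ℝ) {u v : V} (p : G.Walk u v) : Prop :=
  p.IsPath ∧ wlen w p = wdist G w u v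

/-- A clustering: a partition of the vertices into clusters that induce connected subgraphs. -/
structure IsClustering (G : SimpleGraph V) (𝒞 : Set (Set V)) : Prop where
  isPartition : Setoid.IsPartition 𝒞
  connected : ∀ C ∈ 𝒞, (G.induce C).Connected

/-- The cluster graph: its vertices are the clusters, and two distinct clusters are adjacent if
some edge of `G` has its endpoints in them. -/
def clusterGraph (G : SimpleGraph V) (𝒞 : Set (Set V)) : SimpleGraph 𝒞 where
  Adj A B := A ≠ B ∧ ∃ a ∈ A.1, ∃ b ∈ B.1, G.Adj a b
  symm := ⟨fun _ _ h => by
    obtain ⟨hne, a, ha, b, hb, hab⟩ := h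
    exact ⟨hne.symm, b, hb, a, ha, hab.symm⟩⟩
  loopless := ⟨fun _ h => h.1 rfl⟩

/-- `𝒞` is an `(ε, h)`-shortcut partition of the graph `G` with edge weights `w`. If the diameter
of `G` is zero, the quotient in the hop bound is `0`, which is the most restrictive reading. -/
structure IsShortcutPartition (G : SimpleGraph V) (w : Sym2 V → ℝ) (ε h : ℝ)
    (𝒞 : Set (Set V)) : Prop where
  isClustering : IsClustering G 𝒞
  diam_le : ∀ C ∈ 𝒞, strongDiam G w C ≤ ε * wdiam G w
  low_hop : ∀ (u v : V) (p : G.Walk u v), IsShortestPath w p →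
    ∀ A B : 𝒞, u ∈ A.1 → v ∈ B.1 →
      ∃ q : (clusterGraph G 𝒞).Walk A B, q.IsPath ∧
        (q.length : ℝ) ≤ ε * h * (⌈wdist G w u v / (ε * wdiam G w)⌉₊ : ℝ) ∧
        ∀ C ∈ q.support, ∃ x ∈ p.support, x ∈ C.1

end ShortcutPartition

end

/-! The partition comes from a cop decomposition with buffers. Vertices are grouped into supernodes,
created one at a time, and each supernode is divided into clusters. Let `W` be a region still
unassigned and `L` the supernodes that may border it. The members of `L` are connected and pairwise
adjacent, hence branch sets of a clique minor, so there are fewer than `r` of them (`Env.card_lt`).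
If `W` is connected and touches every member of `L`, paths of a shortest-path tree of `W`, from a
root to a neighbour of each member of `L`, form a new supernode, cut into clusters of radius at most
`γ`; its `K` records the current `L`. If `W` is disconnected, its parts are treated separately. If
some `X` in `L` no longer touches `W`, it is retired, after the vertices of `W` within `γ` of the
supernodes younger than `X` have joined clusters of these. A supernode grows only when a member of
its `K` is retired, so cluster radii stay at most `γ * (1 + r)`.

These buffers yield `Sol.far`: a chain of length at most `γ` that starts in a new supernode without
`Z` in its `K` and avoids the supernodes of `L` older than `Z` cannot reach `Z`. Consequently
(`Sol.top`) a short chain always meets some supernode that lies in the `K` of all the others it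
meets, namely the first one created. That supernode was grown from at most `r` shortest paths of a
region containing the chain, so the chain meets at most `M = r * (2 * r + 5)` of its clusters.

For the hop bound, `hasHops_of_top` shortcuts a short chain at those clusters and recurses on the
pieces in between, whose supernodes all have one more known member in `K`. Since `K` has at most `r`
elements, the depth is at most `r + 1` and the cost is exponential in `r * log r`. With `γ = ε *
diam / (2 * (r + 1))` clusters have diameter at most `ε * diam`, and a long path is cut into chains
of length at most `γ`; only its length matters. At distance zero no hop is allowed, so the
decomposition is applied after contracting the edges of weight zero. -/

namespace ShortcutPartition

open Set

/-! ### Bounded walks, chains of vertices, and shortest-path forests. -/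

section Basic

variable {V : Type*} {G : SimpleGraph V} {w : Sym2 V → ℝ}

/-- `Reach G w Z x y t`: some walk from `x` to `y` with all its vertices in `Z` has length at
most `t`. -/
inductive Reach (G : SimpleGraph V) (w : Sym2 V → ℝ) (Z : V → Prop) : V → V → ℝ → Prop
  | refl {x : V} {t : ℝ} : Z x → 0 ≤ t → Reach G w Z x x t
  | step {x y z : V} {t t' : ℝ} : Z x → G.Adj x y → Reach G w Z y z t → w s(x, y) + t ≤ t' →
      Reach G w Z x z t'

theorem Reach.left {Z : V → Prop} {x y : V} {t : ℝ} (h : Reach G w Z x y t) : Z x := by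
  cases h <;> assumption

theorem Reach.right {Z : V → Prop} {x y : V} {t : ℝ} (h : Reach G w Z x y t) : Z y := by
  induction h <;> assumption

theorem Reach.mono {Z Z' : V → Prop} {x y : V} {t t' : ℝ} (h : Reach G w Z x y t)
    (hZ : ∀ u, Z u → Z' u) (ht : t ≤ t') : Reach G w Z' x y t' := by
  induction h generalizing t' with
  | refl hx h0 => exact .refl (hZ _ hx) (h0.trans ht)
  | step hx ha _ hle ih => exact .step (hZ _ hx) ha (ih le_rfl) (hle.trans ht)

theorem Reach.trans {Z : V → Prop} {x y z : V} {a b : ℝ} (h : Reach G w Z x y a)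
    (h' : Reach G w Z y z b) : Reach G w Z x z (a + b) := by
  induction h with
  | refl _ h0 => exact h'.mono (fun _ => id) (by linarith)
  | step hx ha _ hle ih => exact .step hx ha (ih h') (by linarith)

theorem Reach.symm {Z : V → Prop} {x y : V} {t : ℝ} (h : Reach G w Z x y t) :
    Reach G w Z y x t := by
  induction h with
  | refl hx h0 => exact .refl hx h0
  | @step x y z t t' hx ha hr hle ih =>
    have h1 : Reach G w Z y x (w s(x, y)) :=
      .step hr.left ha.symm (.refl hx le_rfl) (by rw [Sym2.eq_swap]; simp)
    exact (ih.trans h1).mono (fun _ => id) (by linarith)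

/-- A function that is `1`-Lipschitz along the edges inside `Z` is so along walks. -/
theorem Reach.lipschitz {Z : V → Prop} {d : V → ℝ}
    (hd : ∀ x y, Z x → Z y → G.Adj x y → d x ≤ d y + w s(x, y))
    {x y : V} {t : ℝ} (h : Reach G w Z x y t) : d x ≤ d y + t := by
  induction h with
  | refl _ h0 => linarith
  | step hx ha hr hle ih => linarith [hd _ _ hx hr.left ha]

/-- The length of a list of vertices as a walk. -/
def chainLen (w : Sym2 V → ℝ) : List V → ℝ
  | [] => 0
  | [_] => 0
  | a :: b :: l => w s(a, b) + chainLen w (b :: l)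

theorem chainLen_nonneg (hw : ∀ x y, G.Adj x y → 0 ≤ w s(x, y)) :
    ∀ {l : List V}, l.IsChain G.Adj → 0 ≤ chainLen w l
  | [], _ => le_rfl
  | [_], _ => le_rfl
  | a :: b :: l, h => by
    rw [List.isChain_cons_cons] at h
    exact add_nonneg (hw _ _ h.1) (chainLen_nonneg hw h.2)

theorem chainLen_append_cons : ∀ (l : List V) (x : V) (l' : List V),
    chainLen w (l ++ x :: l') = chainLen w (l ++ [x]) + chainLen w (x :: l')
  | [], x, l' => by simp [chainLen]
  | [a], x, l' => by simp [chainLen]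
  | a :: b :: l, x, l' => by
    have := chainLen_append_cons (b :: l) x l'
    simp only [List.cons_append, chainLen] at this ⊢
    rw [this]; ring

theorem chainLen_reverse : ∀ l : List V, chainLen w l.reverse = chainLen w l
  | [] => rfl
  | [_] => rfl
  | a :: b :: l => by
    have := chainLen_reverse (b :: l)
    simp only [List.reverse_cons, List.append_assoc, List.cons_append, List.nil_append] at this ⊢
    rw [chainLen_append_cons, this]
    simp [chainLen, Sym2.eq_swap (a := b)]
    ring

theorem chainLen_cons_le (hw : ∀ x y, G.Adj x y → 0 ≤ w s(x, y)) {x : V} {l : List V}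
    (h : (x :: l).IsChain G.Adj) : chainLen w l ≤ chainLen w (x :: l) := by
  cases l with
  | nil => exact le_rfl
  | cons b l =>
    rw [List.isChain_cons_cons] at h
    have := hw _ _ h.1
    simp only [chainLen]; linarith

theorem chainLen_suffix_le (hw : ∀ x y, G.Adj x y → 0 ≤ w s(x, y)) {l l' : List V}
    (h : (l ++ l').IsChain G.Adj) : chainLen w l' ≤ chainLen w (l ++ l') := by
  induction l with
  | nil => exact le_rfl
  | cons a l ih =>
    exact (ih h.tail).trans (chainLen_cons_le hw h)

theorem chainLen_prefix_le (hw : ∀ x y, G.Adj x y → 0 ≤ w s(x, y)) {l l' : List V}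
    (h : (l ++ l').IsChain G.Adj) : chainLen w l ≤ chainLen w (l ++ l') := by
  rw [← chainLen_reverse l, ← chainLen_reverse (l ++ l'), List.reverse_append]
  refine chainLen_suffix_le (G := G) hw ?_
  rw [← List.reverse_append, List.isChain_reverse]
  exact h.imp fun _ _ h => h.symm

/-- Two vertices of a chain inside `Z` are joined by a walk in `Z` of at most its length. -/
theorem reach_of_chain (hw : ∀ x y, G.Adj x y → 0 ≤ w s(x, y)) {Z : V → Prop} :
    ∀ {l : List V} {x : V}, (x :: l).IsChain G.Adj → (∀ u ∈ x :: l, Z u) → ∀ y ∈ x :: l,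
      Reach G w Z x y (chainLen w (x :: l))
  | l, x, h, hZ, y, hy => by
    rcases List.mem_cons.mp hy with rfl | hy'
    · exact .refl (hZ _ (by simp)) (chainLen_nonneg hw h)
    · cases l with
      | nil => simp at hy'
      | cons b l =>
        have h2 := List.isChain_cons_cons.mp h
        exact .step (hZ _ (by simp)) h2.1
          (reach_of_chain hw h2.2 (fun u hu => hZ u (List.mem_cons_of_mem _ hu)) y hy') le_rfl

/-- Iterating a rank-decreasing map until it enters `C`. -/
theorem exists_retract (p : V → V) (n : V → ℕ) (C : Set V) (h : ∀ v ∉ C, n (p v) < n v) :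
    ∃ c : V → V, (∀ v ∈ C, c v = v) ∧ (∀ v ∉ C, c v = c (p v)) ∧ ∀ v, c v ∈ C := by
  classical
  have key : ∀ m v, n v ≤ m → ∃ k, p^[k] v ∈ C := by
    intro m
    induction m with
    | zero =>
      intro v hv
      refine ⟨0, by_contra fun hC => ?_⟩
      have := h v hC; omega
    | succ m ih =>
      intro v hv
      by_cases hC : v ∈ C
      · exact ⟨0, hC⟩
      · obtain ⟨k, hk⟩ := ih (p v) (by have := h v hC; omega)
        exact ⟨k + 1, by simpa using hk⟩
  have ex : ∀ v, ∃ k, p^[k] v ∈ C := fun v => key _ v le_rfl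
  refine ⟨fun v => p^[Nat.find (ex v)] v, fun v hv => ?_, fun v hv => ?_,
    fun v => Nat.find_spec (ex v)⟩
  · have : Nat.find (ex v) = 0 := by rw [Nat.find_eq_zero]; exact hv
    simp [this]
  · have : Nat.find (ex v) = Nat.find (ex (p v)) + 1 := by
      have h1 : ∃ k, p^[k + 1] v ∈ C := by simpa using ex (p v)
      rw [Nat.find_comp_succ (ex v) h1 hv]
      simp only [Function.iterate_succ, Function.comp_apply]
    simp [this]

/-- A partial shortest-path forest with source set `S` in `S ∪ U`, on the vertex set `B`, as it
occurs in Dijkstra's algorithm. -/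
structure IsPartialForest (G : SimpleGraph V) (w : Sym2 V → ℝ) (S U B : Set V) (d : V → ℝ)
    (p : V → V) (n : V → ℕ) : Prop where
  source_subset : S ⊆ B
  subset : B ⊆ S ∪ U
  source : ∀ v ∈ S, d v = 0
  nonneg : ∀ v ∈ B, 0 ≤ d v
  parent : ∀ v ∈ B, v ∉ S → p v ∈ B ∧ G.Adj (p v) v ∧ d v = d (p v) + w s(p v, v) ∧ n (p v) < n v
  lipschitz : ∀ x ∈ B, ∀ y ∈ B, y ∈ U → G.Adj x y → d y ≤ d x + w s(x, y)
  frontier : ∀ x ∈ B, ∀ y ∈ U, y ∉ B → G.Adj x y → ∀ z ∈ B, d z ≤ d x + w s(x, y)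

/-- Shortest-path forests exist. -/
theorem exists_forest [Finite V] (hw : ∀ x y, G.Adj x y → 0 ≤ w s(x, y)) (S U : Set V) :
    ∃ (B : Set V) (d : V → ℝ) (p : V → V) (n : V → ℕ), IsPartialForest G w S U B d p n ∧
      ∀ x ∈ B, ∀ y ∈ U, G.Adj x y → y ∈ B := by
  classical
  have := Fintype.ofFinite V
  have h0 : ∃ d p n, IsPartialForest G w S U S d p n :=
    ⟨fun _ => 0, id, fun _ => 0, ⟨subset_rfl, subset_union_left, fun _ _ => rfl, fun _ _ => le_rfl,
      fun v h h' => absurd h h', fun x _ y _ _ h => by simpa using hw _ _ h,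
      fun x _ y _ _ h _ _ => by simpa using hw _ _ h⟩⟩
  -- In a maximal partial forest no edge leads on into `U`: otherwise Dijkstra's step along a
  -- frontier edge minimising `d x + w s(x, y)` would enlarge it.
  obtain ⟨B, -, ⟨d, p, n, hB⟩, hmax⟩ :=
    (Set.toFinite {B : Set V | ∃ d p n, IsPartialForest G w S U B d p n}).exists_le_maximal h0
  refine ⟨B, d, p, n, hB, ?_⟩
  by_contra! hcon
  obtain ⟨x₀, hx₀, y₀, hy₀, ha₀, hn₀⟩ := hcon
  obtain ⟨⟨x, y⟩, ⟨hx, hy, hyB, ha⟩, hmin⟩ := Set.exists_min_image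
    {q : V × V | q.1 ∈ B ∧ q.2 ∈ U ∧ q.2 ∉ B ∧ G.Adj q.1 q.2} (fun q => d q.1 + w s(q.1, q.2))
    (Set.toFinite _) ⟨(x₀, y₀), hx₀, hy₀, hn₀, ha₀⟩
  have hyS : y ∉ S := fun h => hyB (hB.source_subset h)
  have hne : ∀ z ∈ B, z ≠ y := fun z hz h => hyB (h ▸ hz)
  suffices h : IsPartialForest G w S U (insert y B) (Function.update d y (d x + w s(x, y)))
      (Function.update p y x) (Function.update n y (1 + ∑ z, n z)) from
    hyB (hmax ⟨_, _, _, h⟩ (subset_insert y B) (mem_insert y B))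
  have hd : ∀ z ∈ B, Function.update d y (d x + w s(x, y)) z = d z := fun z hz =>
    Function.update_of_ne (hne z hz) _ _
  have hnn : ∀ z ∈ B, Function.update n y (1 + ∑ z, n z) z = n z := fun z hz =>
    Function.update_of_ne (hne z hz) _ _
  refine ⟨hB.source_subset.trans (subset_insert y B), insert_subset (.inr hy) hB.subset, ?_, ?_, ?_,
    ?_, ?_⟩
  · intro v hv
    rw [hd v (hB.source_subset hv), hB.source v hv]
  · rintro v (rfl | hv)
    · simpa using add_nonneg (hB.nonneg x hx) (hw _ _ ha)
    · rw [hd v hv]; exact hB.nonneg v hv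
  · rintro v (rfl | hv) hvS
    · simp only [Function.update_self]
      refine ⟨.inr hx, ha, by rw [hd x hx], ?_⟩
      rw [hnn x hx]
      have := Finset.single_le_sum (f := n) (fun _ _ => Nat.zero_le _) (Finset.mem_univ x)
      omega
    · rw [Function.update_of_ne (hne v hv), hd v hv, hnn v hv]
      obtain ⟨h1, h2, h3, h4⟩ := hB.parent v hv hvS
      exact ⟨.inr h1, h2, by rw [hd _ h1, h3], by rwa [hnn _ h1]⟩
  · rintro a (rfl | haB) b (rfl | hb) hbU hab
    · exact absurd rfl hab.ne
    · rw [hd b hb, Function.update_self]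
      linarith [hB.frontier x hx a hy hyB ha b hb, hw _ _ hab]
    · rw [hd a haB, Function.update_self]
      exact hmin (a, b) ⟨haB, hy, hyB, hab⟩
    · rw [hd a haB, hd b hb]; exact hB.lipschitz a haB b hb hbU hab
  · intro a haB b hbU hbB hab z hz
    simp only [mem_insert_iff, not_or] at hbB
    have hle : d x + w s(x, y) ≤ Function.update d y (d x + w s(x, y)) a + w s(a, b) := by
      rcases haB with rfl | haB
      · simpa using hw _ _ hab
      · rw [hd a haB]; exact hmin (a, b) ⟨haB, hbU, hbB.2, hab⟩
    refine le_trans ?_ hle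
    rcases hz with rfl | hz
    · simp
    · rw [hd z hz]; exact hB.frontier x hx y hy hyB ha z hz

end Basic

/-! ### The buffered decomposition into supernodes and clusters. -/

section Decomposition

variable {V : Type*} {G : SimpleGraph V} {w : Sym2 V → ℝ} {r M : ℕ} {γ : ℝ}

/-- The state of the decomposition around a set `W` of vertices that have no cluster yet. The
vertices in `A` have one; `s` maps a vertex to the root of its supernode and `f` to the centre of
its cluster. `L` is the set of the supernodes that may touch `W`, and `K X` is the set of the
supernodes that were in `L` when `X` was created. -/
structure Env (G : SimpleGraph V) (w : Sym2 V → ℝ) (r : ℕ) (γ : ℝ) (A W L : Set V) (s f : V → V)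
    (K : V → Set V) : Prop where
  disj : Disjoint A W
  label_notMem : ∀ b ∈ A, s b ∉ W
  alive : ∀ X ∈ L, X ∈ A ∧ s X = X
  card_le : L.ncard ≤ r
  bdry : ∀ b, b ∉ W → ∀ v ∈ W, G.Adj b v → b ∈ A ∧ s b ∈ L
  conn : ∀ b ∈ A, s b ∈ L → ∃ t, Reach G w (fun u => u ∈ A ∧ s u = s b) b (s b) t
  adj : ∀ X ∈ L, ∀ Y ∈ L, X ≠ Y → ∃ x ∈ A, ∃ y ∈ A, s x = X ∧ s y = Y ∧ G.Adj x y
  total : ∀ X ∈ L, ∀ Y ∈ L, X ≠ Y → X ∈ K Y ∨ Y ∈ K X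
  older_notMem : ∀ X ∈ L, Disjoint (K X) W
  rad : ∀ b ∈ A, ∀ v ∈ W, G.Adj b v →
    Reach G w (fun u => u ∈ A ∧ f u = f b ∧ s u = s b) b (f b) (γ * (1 + r - (L ∩ K (s b)).ncard))

/-- An extension of the state from `A` to `A ∪ W`. -/
structure Sol (G : SimpleGraph V) (w : Sym2 V → ℝ) (r M : ℕ) (γ : ℝ) (A W L : Set V) (s f : V → V)
    (K : V → Set V) : Prop where
  label : ∀ v ∈ W, s v ∈ W ∨ s v ∈ L
  rad : ∀ v ∈ W,
    Reach G w (fun u => u ∈ A ∪ W ∧ f u = f v ∧ s u = s v) v (f v) (γ * (1 + r))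
  centre : ∀ v ∈ W, s v ∈ L → f v ∈ A
  card_le : ∀ v ∈ W, s v ∉ L → (K (s v)).ncard ≤ r
  top : ∀ Q : List V, Q ≠ [] → Q.IsChain G.Adj → chainLen w Q ≤ γ → (∀ u ∈ Q, u ∈ W ∧ s u ∉ L) →
    ∃ x ∈ Q, (∃ T : Set V, T.ncard ≤ M ∧ ∀ u ∈ Q, s u = s x → f u ∈ T) ∧
      ∀ u ∈ Q, s u ≠ s x → s x ∈ K (s u)
  far : ∀ Z ∈ L, ∀ (v : V) (l : List V), (v :: l).IsChain G.Adj → chainLen w (v :: l) ≤ γ →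
    v ∈ W → s v ∉ L → Z ∉ K (s v) → (∀ u ∈ v :: l, u ∈ A ∪ W ∧ (s u ∈ L → s u ∉ K Z)) →
      ∀ u ∈ v :: l, u ∈ W ∧ s u ≠ Z

/-- The recursion returns new maps that agree with the old ones only on `A`; no more than that
enters the state. -/
theorem Env.congr {A W L : Set V} {s f s' f' : V → V} {K K' : V → Set V}
    (h : Env G w r γ A W L s f K) (hc : ∀ b ∈ A, s' b = s b ∧ f' b = f b ∧ K' b = K b) :
    Env G w r γ A W L s' f' K' where
  disj := h.disj
  label_notMem b hb := by rw [(hc b hb).1]; exact h.label_notMem b hb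
  alive X hX := ⟨(h.alive X hX).1, by rw [(hc X (h.alive X hX).1).1, (h.alive X hX).2]⟩
  card_le := h.card_le
  bdry b hb v hv ha := by
    have := h.bdry b hb v hv ha
    exact ⟨this.1, by rw [(hc b this.1).1]; exact this.2⟩
  conn b hb hL := by
    rw [(hc b hb).1] at hL ⊢
    obtain ⟨t, ht⟩ := h.conn b hb hL
    exact ⟨t, ht.mono (fun u hu => ⟨hu.1, by rw [(hc u hu.1).1, hu.2]⟩) le_rfl⟩
  adj X hX Y hY hne := by
    obtain ⟨x, hx, y, hy, h1, h2, h3⟩ := h.adj X hX Y hY hne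
    exact ⟨x, hx, y, hy, by rw [(hc x hx).1, h1], by rw [(hc y hy).1, h2], h3⟩
  total X hX Y hY hne := by
    rw [(hc X (h.alive X hX).1).2.2, (hc Y (h.alive Y hY).1).2.2]
    exact h.total X hX Y hY hne
  older_notMem X hX := by
    rw [(hc X (h.alive X hX).1).2.2]; exact h.older_notMem X hX
  rad b hb v hv ha := by
    have hL := (h.bdry b (fun hW => h.disj.notMem_of_mem_left hb hW) v hv ha).2
    rw [(hc b hb).1, (hc b hb).2.1, (hc _ (h.alive _ hL).1).2.2]
    exact (h.rad b hb v hv ha).mono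
      (fun u hu => ⟨hu.1, by rw [(hc u hu.1).2.1, hu.2.1], by rw [(hc u hu.1).1, hu.2.2]⟩) le_rfl

/-! ### Retiring a supernode that has lost contact with `W`. -/

/-- `R` is a part of `W` that may be absorbed by the supernodes younger than `X` when `X` does not
touch `W`: `c` maps the vertices of `R` to close boundary vertices, and nothing in `W \ R` is close
to the boundary. -/
structure IsBuffer (G : SimpleGraph V) (w : Sym2 V → ℝ) (γ : ℝ) (A W L : Set V) (s : V → V)
    (K : V → Set V) (X : V) (R : Set V) (c : V → V) : Prop where
  subset : R ⊆ W
  source : ∀ v ∈ R, c v ∈ A ∧ s (c v) ∈ L ∧ X ∈ K (s (c v)) ∧ ∃ u ∈ W, G.Adj (c v) u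
  reach : ∀ v ∈ R, Reach G w (fun u => (u ∈ R ∧ c u = c v) ∨ u = c v) v (c v) γ
  closed : ∀ (v : V) (l : List V), (v :: l).IsChain G.Adj → chainLen w (v :: l) ≤ γ → v ∈ W →
    v ∉ R → (∀ u ∈ v :: l, u ∈ A ∪ W ∧ (u ∈ A → s u ∈ L → s u ∉ K X)) → ∀ u ∈ v :: l, u ∈ W

theorem IsBuffer.congr {A W L : Set V} {s f s' : V → V} {K K' : V → Set V} {X : V} {R : Set V}
    {c : V → V} (h : IsBuffer G w γ A W L s K X R c) (he : Env G w r γ A W L s f K) (hX : X ∈ L)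
    (hc : ∀ b ∈ A, s' b = s b ∧ K' b = K b) : IsBuffer G w γ A W L s' K' X R c where
  subset := h.subset
  source v hv := by
    obtain ⟨h1, h2, h3, h4⟩ := h.source v hv
    rw [(hc _ h1).1, (hc _ (he.alive _ h2).1).2]
    exact ⟨h1, h2, h3, h4⟩
  reach := h.reach
  closed v l hl hle hv hvR hu := h.closed v l hl hle hv hvR fun u hul =>
    ⟨(hu u hul).1, fun hA hL => by
      have := (hu u hul).2 hA
      rw [(hc u hA).1, (hc X (he.alive X hX).1).2] at this
      exact this hL⟩

/-- A forest and a retraction along its parent map give walks along the forest. -/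
theorem IsPartialForest.reach_retract {S U B : Set V} {d : V → ℝ} {p c : V → V} {n : V → ℕ}
    (hw : ∀ x y, G.Adj x y → 0 ≤ w s(x, y))
    (hB : IsPartialForest G w S U B d p n) {C : Set V} (hSC : S ⊆ C) (hc : ∀ v ∈ C, c v = v)
    (hc' : ∀ v ∉ C, c v = c (p v)) (v : V) (hv : v ∈ B) :
    Reach G w (fun u => u ∈ B ∧ c u = c v ∧ d u ≤ d v) v (c v) (d v - d (c v)) := by
  induction h : n v using Nat.strong_induction_on generalizing v with
  | _ m ih =>
    by_cases hC : v ∈ C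
    · have := hc v hC
      rw [this]
      exact .refl ⟨hv, this, le_rfl⟩ (by simp)
    · obtain ⟨h1, h2, h3, h4⟩ := hB.parent v hv fun hS => hC (hSC hS)
      have h5 := hc' v hC
      rw [h5]
      refine .step ⟨hv, h5, le_rfl⟩ h2.symm
        ((ih _ (h ▸ h4) (p v) h1 rfl).mono (fun u hu => ⟨hu.1, hu.2.1, ?_⟩) le_rfl) ?_
      · linarith [hu.2.2, hw _ _ h2]
      · rw [Sym2.eq_swap]; linarith

/-- The buffer is a ball of radius `γ` around the supernodes younger than `X`. By `total`, a member
of `L` other than `X` is in `K X` or younger than `X`, so a chain avoiding `K X` can leave `W` only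
through a source of the ball; if it is short, it started inside. -/
theorem Env.exists_buffer [Finite V] (hw : ∀ x y, G.Adj x y → 0 ≤ w s(x, y)) {A W L : Set V}
    {s f : V → V} {K : V → Set V} (he : Env G w r γ A W L s f K) {X : V} (hX : X ∈ L)
    (hna : ∀ b ∈ A, s b = X → ∀ v ∈ W, ¬ G.Adj b v) :
    ∃ R c, IsBuffer G w γ A W L s K X R c := by
  set S : Set V := {b | b ∈ A ∧ s b ∈ L ∧ X ∈ K (s b)} with hS
  obtain ⟨B, d, p, n, hB, hfr⟩ := exists_forest hw S W
  -- The part `Bᶜ` is only there to make the retraction total; from `B` it always ends in `S`.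
  obtain ⟨c, hc, hc', hcC⟩ := exists_retract p n (S ∪ Bᶜ) (by
    intro v hv
    simp only [mem_union, mem_compl_iff, not_or, not_not] at hv
    exact (hB.parent v hv.2 hv.1).2.2.2)
  have hcS : ∀ v ∈ B, c v ∈ S := by
    intro v hv
    rcases hcC v with h | h
    · exact h
    · exact absurd (hB.reach_retract hw subset_union_left hc hc' v hv).right.1 h
  have hSW : ∀ v ∈ S, v ∉ W := fun v hv => he.disj.notMem_of_mem_left hv.1
  -- `Env.rad` controls only boundary vertices, so the source that a vertex is attached to must
  -- itself have a neighbour in `W`.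
  have hadj : ∀ m, ∀ v ∈ B, v ∉ S → n v = m → ∃ u ∈ W, G.Adj (c v) u := by
    intro m
    induction m using Nat.strong_induction_on with
    | _ m ih =>
      intro v hv hvS hm
      obtain ⟨h1, h2, h3, h4⟩ := hB.parent v hv hvS
      have hvC : v ∉ S ∪ Bᶜ := by simp [hvS, hv]
      rw [hc' v hvC]
      by_cases hp : p v ∈ S
      · rw [hc _ (.inl hp)]
        exact ⟨v, (hB.subset hv).resolve_left hvS, h2⟩
      · exact ih _ (hm ▸ h4) (p v) h1 hp rfl
  refine ⟨{v | v ∈ W ∧ v ∈ B ∧ d v ≤ γ}, c, fun v hv => hv.1, ?_, ?_, ?_⟩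
  · rintro v ⟨hvW, hvB, hvd⟩
    obtain ⟨h1, h2, h3⟩ := hcS v hvB
    exact ⟨h1, h2, h3, hadj _ v hvB (fun h => hSW v h hvW) rfl⟩
  · rintro v ⟨hvW, hvB, hvd⟩
    refine (hB.reach_retract hw subset_union_left hc hc' v hvB).mono ?_ ?_
    · rintro u ⟨hu, huc, hud⟩
      rcases hB.subset hu with h | h
      · exact .inr (by rw [← huc, hc u (.inl h)])
      · exact .inl ⟨⟨h, hu, hud.trans hvd⟩, huc⟩
    · rw [hB.source _ (hcS v hvB)]; linarith
  · have key : ∀ (l : List V) (v : V), (v :: l).IsChain G.Adj → v ∈ W →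
        (∀ u ∈ v :: l, u ∈ A ∪ W ∧ (u ∈ A → s u ∈ L → s u ∉ K X)) →
        (∀ u ∈ v :: l, u ∈ W) ∨ (v ∈ B ∧ d v ≤ chainLen w (v :: l)) := by
      intro l
      induction l with
      | nil => intro v _ hv _; left; simpa using hv
      | cons u l ih =>
        intro v hl hv hu
        rw [List.isChain_cons_cons] at hl
        have hnn := chainLen_nonneg hw hl.2
        by_cases huW : u ∈ W
        · rcases ih u hl.2 huW (fun z hz => hu z (List.mem_cons_of_mem _ hz)) with h | ⟨h1, h2⟩
          · left
            intro z hz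
            rcases List.mem_cons.mp hz with rfl | hz
            · exact hv
            · exact h z hz
          · right
            have hvB := hfr u h1 v hv hl.1.symm
            refine ⟨hvB, (hB.lipschitz u h1 v hvB hv hl.1.symm).trans ?_⟩
            simp only [chainLen]; rw [Sym2.eq_swap]; linarith
        · right
          obtain ⟨huA, huL⟩ := he.bdry u huW v hv hl.1.symm
          have hne : s u ≠ X := fun h => hna u huA h v hv hl.1.symm
          have huS : u ∈ S := ⟨huA, huL,
            (he.total _ hX _ huL hne.symm).resolve_right ((hu u (by simp)).2 huA huL)⟩
          have huB := hB.source_subset huS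
          have hvB := hfr u huB v hv hl.1.symm
          refine ⟨hvB, (hB.lipschitz u huB v hvB hv hl.1.symm).trans ?_⟩
          rw [hB.source u huS]
          simp only [chainLen]; rw [Sym2.eq_swap]; linarith
    intro v l hl hle hv hvR hu
    rcases key l v hl hv hu with h | ⟨h1, h2⟩
    · exact h
    · exact absurd ⟨hv, h1, h2.trans hle⟩ hvR

/-- Absorption costs up to `γ` in radius, but only for supernodes with `X` in their `K`. Removing
`X` from `L` lowers `(L ∩ K (s b)).ncard` by one for these, which raises the allowance in `rad` by
exactly `γ`. -/
theorem Env.absorb [Finite V] (hγ : 0 ≤ γ) {A W L : Set V} {s f : V → V} {K : V → Set V}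
    (he : Env G w r γ A W L s f K) {X : V} (hX : X ∈ L)
    (hna : ∀ b ∈ A, s b = X → ∀ v ∈ W, ¬ G.Adj b v) {R : Set V} {c : V → V}
    (hR : IsBuffer G w γ A W L s K X R c) (hs : ∀ v ∈ R, s v = s (c v) ∧ f v = f (c v)) :
    Env G w r γ (A ∪ R) (W \ R) (L \ {X}) s f K := by
  have hLs : L \ {X} ⊆ L := sdiff_subset
  have hbd : ∀ b, b ∉ W → ∀ v ∈ W, G.Adj b v → b ∈ A ∧ s b ∈ L \ {X} := fun b hb v hv ha => by
    have h := he.bdry b hb v hv ha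
    exact ⟨h.1, h.2, fun h' => hna b h.1 h' v hv ha⟩
  have hreach : ∀ v ∈ R, Reach G w (fun u => u ∈ A ∪ R ∧ f u = f v ∧ s u = s v) v (c v) γ := by
    intro v hv
    refine (hR.reach v hv).mono (fun u hu => ?_) le_rfl
    rcases hu with ⟨hu, huc⟩ | rfl
    · exact ⟨.inr hu, by rw [(hs u hu).2, (hs v hv).2, huc], by rw [(hs u hu).1, (hs v hv).1, huc]⟩
    · exact ⟨.inl (hR.source v hv).1, (hs v hv).2.symm, (hs v hv).1.symm⟩
  have hcard : ∀ Y, ((L \ {X}) ∩ K Y).ncard ≤ (L ∩ K Y).ncard := fun Y =>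
    ncard_le_ncard (inter_subset_inter_left _ hLs)
  have hcard' : ∀ Y, X ∈ K Y → (((L \ {X}) ∩ K Y).ncard : ℝ) + 1 ≤ (L ∩ K Y).ncard := by
    intro Y hY
    have h1 : (L \ {X}) ∩ K Y = (L ∩ K Y) \ {X} := by
      ext z; simp only [mem_inter_iff, mem_sdiff, mem_singleton_iff]; tauto
    have h2 := ncard_sdiff_singleton_add_one (s := L ∩ K Y) ⟨hX, hY⟩
    rw [h1]; exact_mod_cast h2.le
  refine ⟨?_, ?_, ?_, ?_, ?_, ?_, ?_, ?_, ?_, ?_⟩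
  · rw [disjoint_union_left]
    exact ⟨he.disj.mono_right sdiff_subset, disjoint_sdiff_right⟩
  · rintro b (hb | hb) h
    · exact he.label_notMem b hb h.1
    · rw [(hs b hb).1] at h
      exact he.label_notMem _ (hR.source b hb).1 h.1
  · exact fun Y hY => ⟨.inl (he.alive Y hY.1).1, (he.alive Y hY.1).2⟩
  · exact (ncard_le_ncard hLs).trans he.card_le
  · intro b hb v hv ha
    by_cases hbW : b ∈ W
    · have hbR : b ∈ R := by by_contra h; exact hb ⟨hbW, h⟩
      obtain ⟨h1, -, -, u, hu, hau⟩ := hR.source b hbR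
      refine ⟨.inr hbR, ?_⟩
      rw [(hs b hbR).1]
      exact (hbd _ (he.disj.notMem_of_mem_left h1) u hu hau).2
    · exact ⟨.inl (hbd b hbW v hv.1 ha).1, (hbd b hbW v hv.1 ha).2⟩
  · rintro b (hb | hb) hL
    · obtain ⟨t, ht⟩ := he.conn b hb hL.1
      exact ⟨t, ht.mono (fun u hu => ⟨.inl hu.1, hu.2⟩) le_rfl⟩
    · obtain ⟨h1, h2, h3, -⟩ := hR.source b hb
      obtain ⟨t, ht⟩ := he.conn (c b) h1 h2
      rw [(hs b hb).1]
      refine ⟨γ + t, Reach.trans ((hreach b hb).mono (fun u hu => ⟨hu.1, ?_⟩) le_rfl)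
        (ht.mono (fun u hu => ⟨.inl hu.1, hu.2⟩) le_rfl)⟩
      rw [hu.2.2, (hs b hb).1]
  · intro Y hY Z hZ hne
    obtain ⟨x, hx, y, hy, h⟩ := he.adj Y hY.1 Z hZ.1 hne
    exact ⟨x, .inl hx, y, .inl hy, h⟩
  · exact fun Y hY Z hZ => he.total Y hY.1 Z hZ.1
  · exact fun Y hY => (he.older_notMem Y hY.1).mono_right sdiff_subset
  · rintro b (hb | hb) v hv ha
    · refine (he.rad b hb v hv.1 ha).mono (fun u hu => ⟨.inl hu.1, hu.2⟩) ?_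
      have : (((L \ {X}) ∩ K (s b)).ncard : ℝ) ≤ (L ∩ K (s b)).ncard := mod_cast hcard _
      exact mul_le_mul_of_nonneg_left (by linarith) hγ
    · obtain ⟨h1, h2, h3, u, hu, hau⟩ := hR.source b hb
      have h4 := (hreach b hb).trans ((he.rad (c b) h1 u hu hau).mono
        (fun u hu => ⟨.inl hu.1, by rw [hu.2.1, (hs b hb).2], by rw [hu.2.2, (hs b hb).1]⟩) le_rfl)
      rw [(hs b hb).1, (hs b hb).2]
      rw [(hs b hb).1, (hs b hb).2] at h4
      refine h4.mono (fun _ => id) ?_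
      have := mul_le_mul_of_nonneg_left (hcard' _ h3) hγ
      linarith

/-- Absorbed vertices carry labels in `L`, so `top` and `card_le` do not see them. The one new case
of `far` is `Z = X`, which is what `IsBuffer.closed` provides. -/
theorem Sol.of_absorb [Finite V] (hγ : 0 ≤ γ) {A W L : Set V} {s f : V → V} {K : V → Set V}
    (he : Env G w r γ A W L s f K) {X : V} (hX : X ∈ L) {R : Set V} {c : V → V}
    (hR : IsBuffer G w γ A W L s K X R c) (hs : ∀ v ∈ R, s v = s (c v) ∧ f v = f (c v))
    (h : Sol G w r M γ (A ∪ R) (W \ R) (L \ {X}) s f K) :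
    Sol G w r M γ A W L s f K := by
  have hA : A ∪ R ∪ (W \ R) = A ∪ W := by
    rw [union_assoc, union_sdiff_cancel hR.subset]
  have hRL : ∀ v ∈ R, s v ∈ L := fun v hv => by
    rw [(hs v hv).1]; exact (hR.source v hv).2.1
  have hXW : X ∉ W := he.disj.notMem_of_mem_left (he.alive X hX).1
  have hnX : ∀ v ∈ W, v ∉ R → s v ≠ X := by
    intro v hv hvR h'
    rcases h.label v ⟨hv, hvR⟩ with h1 | h1
    · exact hXW (h' ▸ h1.1)
    · exact h1.2 h'
  have hrR : ∀ v ∈ R, Reach G w (fun u => u ∈ A ∪ W ∧ f u = f v ∧ s u = s v) v (f v)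
      (γ * (1 + r)) ∧ f v ∈ A := by
    intro v hv
    obtain ⟨h1, h2, h3, u, hu, hau⟩ := hR.source v hv
    have h0 : Reach G w (fun u => u ∈ A ∪ W ∧ f u = f v ∧ s u = s v) v (c v) γ := by
      refine (hR.reach v hv).mono (fun u hu => ?_) le_rfl
      rcases hu with ⟨hu, huc⟩ | rfl
      · exact ⟨.inr (hR.subset hu), by rw [(hs u hu).2, (hs v hv).2, huc],
          by rw [(hs u hu).1, (hs v hv).1, huc]⟩
      · exact ⟨.inl h1, (hs v hv).2.symm, (hs v hv).1.symm⟩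
    have h4 := he.rad (c v) h1 u hu hau
    have h5 := h0.trans (h4.mono
      (fun u hu => ⟨.inl hu.1, by rw [hu.2.1, (hs v hv).2], by rw [hu.2.2, (hs v hv).1]⟩) le_rfl)
    rw [← (hs v hv).2] at h5
    refine ⟨h5.mono (fun _ => id) ?_, by rw [(hs v hv).2]; exact h4.right.1⟩
    -- Since `X` is counted here, the old radius was at most `γ * r`, leaving room for one more `γ`.
    have h6 : (1 : ℝ) ≤ (L ∩ K (s (c v))).ncard := by
      have : (L ∩ K (s (c v))).Nonempty := ⟨X, hX, h3⟩
      exact_mod_cast (ncard_pos (toFinite _)).mpr this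
    have := mul_le_mul_of_nonneg_left h6 hγ
    linarith
  refine ⟨?_, ?_, ?_, ?_, ?_, ?_⟩
  · intro v hv
    by_cases hvR : v ∈ R
    · exact .inr (hRL v hvR)
    · exact (h.label v ⟨hv, hvR⟩).imp (fun h => h.1) (fun h => h.1)
  · intro v hv
    by_cases hvR : v ∈ R
    · exact (hrR v hvR).1
    · simpa only [hA] using h.rad v ⟨hv, hvR⟩
  · intro v hv hvL
    by_cases hvR : v ∈ R
    · exact (hrR v hvR).2
    · have h1 := h.centre v ⟨hv, hvR⟩ ⟨hvL, hnX v hv hvR⟩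
      rcases h1 with h1 | h1
      · exact h1
      · have h2 := (h.rad v ⟨hv, hvR⟩).right.2.1
        rw [← h2]; exact (hrR _ h1).2
  · intro v hv hvL
    have hvR : v ∉ R := fun h' => hvL (hRL v h')
    exact h.card_le v ⟨hv, hvR⟩ (fun h' => hvL h'.1)
  · intro Q hne hQ hle hQW
    exact h.top Q hne hQ hle fun u hu =>
      ⟨⟨(hQW u hu).1, fun h' => (hQW u hu).2 (hRL u h')⟩, fun h' => (hQW u hu).2 h'.1⟩
  · intro Z hZ v l hl hle hv hvL hZK hu
    have hvR : v ∉ R := fun h' => hvL (hRL v h')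
    by_cases hZX : Z = X
    · subst hZX
      have h1 := hR.closed v l hl hle hv hvR fun u hul => ⟨(hu u hul).1, fun _ => (hu u hul).2⟩
      intro u hul
      refine ⟨h1 u hul, ?_⟩
      by_cases huR : u ∈ R
      · intro h'
        have h2 := (hR.source u huR).2.2.1
        have h3 := (hu u hul).2 (hRL u huR)
        rw [← (hs u huR).1, h'] at h2
        rw [h'] at h3
        exact h3 h2
      · exact hnX u (h1 u hul) huR
    · intro u hul
      have := h.far Z ⟨hZ, hZX⟩ v l hl hle ⟨hv, hvR⟩ (fun h' => hvL h'.1) hZK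
        (fun u hul => ⟨by rw [hA]; exact (hu u hul).1, fun h' => (hu u hul).2 h'.1⟩) u hul
      exact ⟨this.1.1, this.2⟩

/-! ### Splitting `W` into parts without edges between them. -/

theorem Env.mono_right {A W C L : Set V} {s f : V → V} {K : V → Set V}
    (he : Env G w r γ A W L s f K) (hC : C ⊆ W)
    (hcut : ∀ b ∈ W, b ∉ C → ∀ v ∈ C, ¬ G.Adj b v) : Env G w r γ A C L s f K where
  disj := he.disj.mono_right hC
  label_notMem b hb h := he.label_notMem b hb (hC h)
  alive := he.alive
  card_le := he.card_le
  bdry b hb v hv ha := he.bdry b (fun hbW => hcut b hbW hb v hv ha) v (hC hv) ha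
  conn := he.conn
  adj := he.adj
  total := he.total
  older_notMem X hX := (he.older_notMem X hX).mono_right hC
  rad b hb v hv ha := he.rad b hb v (hC hv) ha

theorem Sol.congr {A W L : Set V} {s f s' f' : V → V} {K K' : V → Set V}
    (h : Sol G w r M γ A W L s f K) (hL : L ⊆ A)
    (hc : ∀ v ∈ A ∪ W, s' v = s v ∧ f' v = f v ∧ K' v = K v) :
    Sol G w r M γ A W L s' f' K' := by
  have hs : ∀ v ∈ W, s' v = s v := fun v hv => (hc v (.inr hv)).1
  have hf : ∀ v ∈ W, f' v = f v := fun v hv => (hc v (.inr hv)).2.1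
  have hK : ∀ v ∈ W, K' (s v) = K (s v) := fun v hv =>
    (hc _ ((h.label v hv).elim (fun h => .inr h) fun h => .inl (hL h))).2.2
  refine ⟨?_, ?_, ?_, ?_, ?_, ?_⟩
  · intro v hv; rw [hs v hv]; exact h.label v hv
  · intro v hv
    rw [hs v hv, hf v hv]
    exact (h.rad v hv).mono
      (fun u hu => ⟨hu.1, by rw [(hc u hu.1).2.1, hu.2.1], by rw [(hc u hu.1).1, hu.2.2]⟩) le_rfl
  · intro v hv; rw [hs v hv, hf v hv]; exact h.centre v hv
  · intro v hv; rw [hs v hv, hK v hv]; exact h.card_le v hv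
  · intro Q hne hQ hle hQW
    obtain ⟨x, hx, ⟨T, hT, hT'⟩, h2⟩ := h.top Q hne hQ hle fun u hu => by
      rw [← hs u (hQW u hu).1]; exact hQW u hu
    refine ⟨x, hx, ⟨T, hT, fun u hu => ?_⟩, fun u hu => ?_⟩
    · rw [hs u (hQW u hu).1, hs x (hQW x hx).1, hf u (hQW u hu).1]; exact hT' u hu
    · rw [hs u (hQW u hu).1, hs x (hQW x hx).1, hK u (hQW u hu).1]; exact h2 u hu
  · intro Z hZ v l hl hle hv hvL hZK hu
    rw [hs v hv] at hvL hZK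
    rw [hK v hv] at hZK
    have h2 := h.far Z hZ v l hl hle hv hvL hZK fun u hul => by
      have := hu u hul
      rw [(hc u this.1).1, (hc Z (.inl (hL hZ))).2.2] at this
      exact this
    intro u hul
    rw [hs u (h2 u hul).1]
    exact h2 u hul

/-- A chain that cannot leave `C` without violating a property stays in `C`. -/
theorem chain_subset_of_step {C : Set V} : ∀ (l : List V) (v : V), (v :: l).IsChain G.Adj →
    v ∈ C → (∀ l₁ x y l₂, v :: l = l₁ ++ x :: y :: l₂ → G.Adj x y → (∀ u ∈ l₁, u ∈ C) → x ∈ C →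
      y ∈ C) → ∀ u ∈ v :: l, u ∈ C
  | [], v, _, hv, _ => by simpa using hv
  | a :: l, v, hl, hv, h => by
    rw [List.isChain_cons_cons] at hl
    have ha : a ∈ C := h [] v a l rfl hl.1 (by simp) hv
    have := chain_subset_of_step l a hl.2 ha fun l₁ x y l₂ he hxy hu hx =>
      h (v :: l₁) x y l₂ (by rw [he]; rfl) hxy (by simpa using ⟨hv, hu⟩) hx
    intro u hu
    rcases List.mem_cons.mp hu with rfl | hu
    · exact hv
    · exact this u hu

/-- The conclusion of `Sol.far` for a part of `W` without edges to the rest. -/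
theorem Sol.far_of_part {A W C L : Set V} {s f : V → V} {K : V → Set V}
    (hw : ∀ x y, G.Adj x y → 0 ≤ w s(x, y))
    (he : Env G w r γ A W L s f K) (hC : C ⊆ W)
    (hcut : ∀ b ∈ W, b ∉ C → ∀ v ∈ C, ¬ G.Adj b v) (h : Sol G w r M γ A C L s f K)
    (Z : V) (hZ : Z ∈ L) (v : V) (l : List V) (hl : (v :: l).IsChain G.Adj)
    (hle : chainLen w (v :: l) ≤ γ) (hv : v ∈ C) (hvL : s v ∉ L) (hZK : Z ∉ K (s v))
    (hu : ∀ u ∈ v :: l, u ∈ A ∪ W ∧ (s u ∈ L → s u ∉ K Z)) : ∀ u ∈ v :: l, u ∈ C ∧ s u ≠ Z := by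
  have hsub : ∀ u ∈ v :: l, u ∈ C := by
    refine chain_subset_of_step l v hl hv fun l₁ x y l₂ heq hxy h1 hx => ?_
    by_contra hy
    have hyA : y ∈ A := by
      have hyW : y ∉ W := fun hyW => hcut y hyW hy x hx hxy.symm
      exact (he.bdry y hyW x (hC hx) hxy.symm).1
    have hpre : v :: l = (l₁ ++ [x, y]) ++ l₂ := by rw [heq]; simp
    -- The prefix ending at the first exit `y` lies in `A ∪ C`, so `h.far` applies to it and forces
    -- `y ∈ C`.
    obtain ⟨l', hl'⟩ : ∃ l', l₁ ++ [x, y] = v :: l' := by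
      cases l₁ with
      | nil => simp only [List.nil_append, List.cons.injEq] at heq; exact ⟨[y], by simp [heq.1]⟩
      | cons a l₁ => simp only [List.cons_append, List.cons.injEq] at heq; exact ⟨_, by
          rw [heq.1]; rfl⟩
    rw [hl'] at hpre
    have h2 := h.far Z hZ v l' (List.isChain_append.mp (hpre ▸ hl)).1
      ((chainLen_prefix_le hw (hpre ▸ hl)).trans (hpre ▸ hle)) hv hvL hZK (by
        intro u hul
        refine ⟨?_, (hu u (by rw [hpre]; exact List.mem_append_left _ hul)).2⟩
        rw [← hl'] at hul
        simp only [List.mem_append, List.mem_cons, List.not_mem_nil, or_false] at hul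
        rcases hul with hul | rfl | rfl
        · exact .inr (h1 u hul)
        · exact .inr hx
        · exact .inl hyA) y (by rw [← hl']; simp)
    exact hy h2.1
  exact h.far Z hZ v l hl hle hv hvL hZK fun u hul => ⟨.inr (hsub u hul), (hu u hul).2⟩

/-- Solutions on two parts of `W` without edges between them are a solution on `W`. -/
theorem Sol.of_split {A W C D L : Set V} {s f : V → V} {K : V → Set V}
    (hw : ∀ x y, G.Adj x y → 0 ≤ w s(x, y)) (he : Env G w r γ A W L s f K)
    (hW : W = C ∪ D) (hcut : ∀ b ∈ C, ∀ v ∈ D, ¬ G.Adj b v)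
    (hC : Sol G w r M γ A C L s f K) (hD : Sol G w r M γ A D L s f K) :
    Sol G w r M γ A W L s f K := by
  have hCW : C ⊆ W := hW ▸ subset_union_left
  have hDW : D ⊆ W := hW ▸ subset_union_right
  have hcC : ∀ b ∈ W, b ∉ C → ∀ v ∈ C, ¬ G.Adj b v := fun b hb hbC v hv ha =>
    hcut v hv b ((hW ▸ hb : b ∈ C ∪ D).resolve_left hbC) ha.symm
  have hcD : ∀ b ∈ W, b ∉ D → ∀ v ∈ D, ¬ G.Adj b v := fun b hb hbD v hv ha =>
    hcut b ((hW ▸ hb : b ∈ C ∪ D).resolve_right hbD) v hv ha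
  have hWW : ∀ v ∈ W, v ∈ C ∨ v ∈ D := fun v hv => by simpa [hW] using hv
  refine ⟨?_, ?_, ?_, ?_, ?_, ?_⟩
  · intro v hv
    rcases hWW v hv with h | h
    · exact (hC.label v h).imp_left fun h => hCW h
    · exact (hD.label v h).imp_left fun h => hDW h
  · intro v hv
    rcases hWW v hv with h | h
    · exact (hC.rad v h).mono (fun u hu => ⟨union_subset_union_right A hCW hu.1, hu.2⟩) le_rfl
    · exact (hD.rad v h).mono (fun u hu => ⟨union_subset_union_right A hDW hu.1, hu.2⟩) le_rfl
  · intro v hv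
    rcases hWW v hv with h | h
    · exact hC.centre v h
    · exact hD.centre v h
  · intro v hv
    rcases hWW v hv with h | h
    · exact hC.card_le v h
    · exact hD.card_le v h
  · intro Q hne hQ hle hQW
    obtain ⟨v, l, rfl⟩ := List.exists_cons_of_ne_nil hne
    have hin : ∀ E ⊆ W, (∀ b ∈ W, b ∉ E → ∀ v ∈ E, ¬ G.Adj b v) → v ∈ E → ∀ u ∈ v :: l, u ∈ E := by
      intro E hE hcE hv
      refine chain_subset_of_step l v hQ hv fun l₁ x y l₂ heq hxy _ hx => ?_
      by_contra hy
      exact hcE y (hQW y (by rw [heq]; simp)).1 hy x hx hxy.symm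
    rcases hWW v (hQW v (by simp)).1 with h | h
    · exact hC.top _ hne hQ hle fun u hu => ⟨hin C hCW hcC h u hu, (hQW u hu).2⟩
    · exact hD.top _ hne hQ hle fun u hu => ⟨hin D hDW hcD h u hu, (hQW u hu).2⟩
  · intro Z hZ v l hl hle hv hvL hZK hu
    rcases hWW v hv with h | h
    · exact fun u hul =>
        ((Sol.far_of_part hw he hCW hcC hC Z hZ v l hl hle h hvL hZK hu) u hul).imp_left
          fun h => hCW h
    · exact fun u hul =>
        ((Sol.far_of_part hw he hDW hcD hD Z hZ v l hl hle h hvL hZK hu) u hul).imp_left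
          fun h => hDW h

/-! ### Creating a supernode. -/

/-- The skeleton tree `T` of a new supernode in `W` with root `root`, its net `c`, and the
distance `d` from the root. -/
structure IsSkeleton (G : SimpleGraph V) (w : Sym2 V → ℝ) (r M : ℕ) (γ : ℝ) (A W L : Set V)
    (s : V → V) (root : V) (T : Set V) (c : V → V) (d : V → ℝ) : Prop where
  subset : T ⊆ W
  root_mem : root ∈ T
  conn : ∀ v ∈ T, ∃ t, Reach G w (fun u => u ∈ T) v root t
  touch : ∀ X ∈ L, ∃ b ∈ A, ∃ a ∈ T, s b = X ∧ G.Adj b a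
  reach : ∀ v ∈ T, Reach G w (fun u => u ∈ T ∧ c u = c v) v (c v) γ
  lipschitz : ∀ x ∈ W, ∀ y ∈ W, G.Adj x y → d x ≤ d y + w s(x, y)
  count : ∀ x : ℝ, {t | t ∈ T ∧ c t = t ∧ |d t - x| ≤ γ * (2 + r)}.ncard ≤ M

/-- Touching all of `L` keeps the alive supernodes pairwise adjacent, and `K root = L` keeps them
comparable. The radius allowance of the new clusters is `γ * (1 + r - L.ncard)`, at least the `γ`
they need. -/
theorem Env.create [Finite V] (hγ : 0 ≤ γ) {A W L : Set V} {s f : V → V} {K : V → Set V}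
    (he : Env G w r γ A W L s f K) {root : V} {T : Set V} {c : V → V} {d : V → ℝ}
    (hT : IsSkeleton G w r M γ A W L s root T c d) (hL : L.ncard < r) (hK : K root = L)
    (hs : ∀ v ∈ T, s v = root ∧ f v = c v) :
    Env G w r γ (A ∪ T) (W \ T) (insert root L) s f K := by
  have hrW : root ∈ W := hT.subset hT.root_mem
  have hrA : root ∉ A := he.disj.notMem_of_mem_right hrW
  have hsL : ∀ b ∈ A, s b ≠ root := fun b hb h => he.label_notMem b hb (h ▸ hrW)
  have hrL : root ∉ L := fun h => hrA (he.alive _ h).1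
  have hsub : ∀ X ∈ L, insert root L ∩ K X = L ∩ K X := by
    intro X hX
    rw [insert_inter_of_notMem]
    exact fun h => (he.older_notMem X hX).notMem_of_mem_left h hrW
  refine ⟨?_, ?_, ?_, ?_, ?_, ?_, ?_, ?_, ?_, ?_⟩
  · rw [disjoint_union_left]
    exact ⟨he.disj.mono_right sdiff_subset, disjoint_sdiff_right⟩
  · rintro b (hb | hb) h
    · exact he.label_notMem b hb h.1
    · rw [(hs b hb).1] at h
      exact h.2 hT.root_mem
  · rintro X (rfl | hX)
    · exact ⟨.inr hT.root_mem, (hs _ hT.root_mem).1⟩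
    · exact ⟨.inl (he.alive X hX).1, (he.alive X hX).2⟩
  · exact (ncard_insert_le _ _).trans hL
  · intro b hb v hv ha
    by_cases hbW : b ∈ W
    · have hbT : b ∈ T := by by_contra h; exact hb ⟨hbW, h⟩
      exact ⟨.inr hbT, .inl (hs b hbT).1⟩
    · have := he.bdry b hbW v hv.1 ha
      exact ⟨.inl this.1, .inr this.2⟩
  · rintro b (hb | hb) hbL
    · obtain ⟨t, ht⟩ := he.conn b hb (hbL.resolve_left (hsL b hb))
      exact ⟨t, ht.mono (fun u hu => ⟨.inl hu.1, hu.2⟩) le_rfl⟩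
    · obtain ⟨t, ht⟩ := hT.conn b hb
      rw [(hs b hb).1]
      exact ⟨t, ht.mono (fun u hu => ⟨.inr hu, (hs u hu).1⟩) le_rfl⟩
  · rintro X (rfl | hX) Y (rfl | hY) hne
    · exact absurd rfl hne
    · obtain ⟨b, hb, a, ha, h1, h2⟩ := hT.touch Y hY
      exact ⟨a, .inr ha, b, .inl hb, (hs a ha).1, h1, h2.symm⟩
    · obtain ⟨b, hb, a, ha, h1, h2⟩ := hT.touch X hX
      exact ⟨b, .inl hb, a, .inr ha, h1, (hs a ha).1, h2⟩
    · obtain ⟨x, hx, y, hy, h⟩ := he.adj X hX Y hY hne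
      exact ⟨x, .inl hx, y, .inl hy, h⟩
  · rintro X (rfl | hX) Y (rfl | hY) hne
    · exact absurd rfl hne
    · exact .inr (hK ▸ hY)
    · exact .inl (hK ▸ hX)
    · exact he.total X hX Y hY hne
  · rintro X (rfl | hX)
    · rw [hK, disjoint_left]
      exact fun Y hY h => he.disj.notMem_of_mem_left (he.alive Y hY).1 h.1
    · exact (he.older_notMem X hX).mono_right sdiff_subset
  · rintro b (hb | hb) v hv ha
    · have hbL := (he.bdry b (he.disj.notMem_of_mem_left hb) v hv.1 ha).2
      rw [hsub _ hbL]
      exact (he.rad b hb v hv.1 ha).mono (fun u hu => ⟨.inl hu.1, hu.2⟩) le_rfl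
    · rw [(hs b hb).1, (hs b hb).2]
      refine (hT.reach b hb).mono
        (fun u hu => ⟨.inr hu.1, by rw [(hs u hu.1).2, hu.2], (hs u hu.1).1⟩) ?_
      rw [hK, insert_inter_of_notMem hrL, inter_self]
      have h1 : (L.ncard : ℝ) ≤ r := mod_cast hL.le
      nlinarith

/-- A short chain that meets the new supernode can use it in `top`. Its clusters on the chain have
centres whose distances from the root lie in one narrow window, and `far` with `Z = root` forces
every other supernode on the chain to have `root` in its `K`. -/
theorem Sol.of_create [Finite V] (hw : ∀ x y, G.Adj x y → 0 ≤ w s(x, y)) (hγ : 0 ≤ γ)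
    {A W L : Set V} {s f : V → V} {K : V → Set V}
    (he : Env G w r γ A W L s f K) {root : V} {T : Set V} {c : V → V} {d : V → ℝ}
    (hT : IsSkeleton G w r M γ A W L s root T c d) (hL : L.ncard < r) (hK : K root = L)
    (hs : ∀ v ∈ T, s v = root ∧ f v = c v)
    (h : Sol G w r M γ (A ∪ T) (W \ T) (insert root L) s f K) :
    Sol G w r M γ A W L s f K := by
  have hrW : root ∈ W := hT.subset hT.root_mem
  have hrA : root ∉ A := he.disj.notMem_of_mem_right hrW
  have hsA : ∀ b ∈ A, s b ≠ root := fun b hb h => he.label_notMem b hb (h ▸ hrW)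
  have hrL : root ∉ L := fun h => hrA (he.alive _ h).1
  have hA : A ∪ T ∪ (W \ T) = A ∪ W := by
    rw [union_assoc, union_sdiff_cancel hT.subset]
  have hrad : ∀ v ∈ W, Reach G w (fun u => u ∈ A ∪ W ∧ f u = f v ∧ s u = s v) v (f v)
      (γ * (1 + r)) := by
    intro v hv
    by_cases hvT : v ∈ T
    · have := hT.reach v hvT
      rw [← (hs v hvT).2] at this
      refine this.mono (fun u hu => ⟨.inr (hT.subset hu.1), by rw [(hs u hu.1).2, hu.2], by
        rw [(hs u hu.1).1, (hs v hvT).1]⟩) ?_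
      have : (0 : ℝ) ≤ r := Nat.cast_nonneg r
      nlinarith
    · simpa only [hA] using h.rad v ⟨hv, hvT⟩
  refine ⟨?_, hrad, ?_, ?_, ?_, ?_⟩
  · intro v hv
    by_cases hvT : v ∈ T
    · exact .inl (by rw [(hs v hvT).1]; exact hrW)
    · rcases h.label v ⟨hv, hvT⟩ with h1 | h1 | h1
      · exact .inl h1.1
      · exact .inl (h1 ▸ hrW)
      · exact .inr h1
  · intro v hv hvL
    have hvT : v ∉ T := fun h' => hrL ((hs v h').1 ▸ hvL)
    rcases h.centre v ⟨hv, hvT⟩ (.inr hvL) with h1 | h1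
    · exact h1
    · have := (hrad v hv).right.2.2
      rw [(hs _ h1).1] at this
      exact absurd (this ▸ hvL) hrL
  · intro v hv hvL
    by_cases hvr : s v = root
    · rw [hvr, hK]; exact hL.le
    · have hvT : v ∉ T := fun h' => hvr (hs v h').1
      exact h.card_le v ⟨hv, hvT⟩ fun h' => h'.elim hvr hvL
  · intro Q hne hQ hle hQW
    by_cases hx : ∃ x ∈ Q, s x = root
    · obtain ⟨x, hxQ, hxr⟩ := hx
      refine ⟨x, hxQ, ⟨_, hT.count (d x), fun u hu hus => ?_⟩, fun u hu hus => ?_⟩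
      · rw [hxr] at hus
        have hr1 := hrad u (hQW u hu).1
        have hsub : ∀ z, z ∈ A ∪ W ∧ f z = f u ∧ s z = s u → z ∈ W := by
          rintro z ⟨hz | hz, -, hz'⟩
          · exact absurd (hz'.trans hus) (hsA z hz)
          · exact hz
        have hfW : f u ∈ W := hsub _ hr1.right
        have hlip : ∀ a b t, Reach G w (fun z => z ∈ W) a b t → |d a - d b| ≤ t := by
          intro a b t hr
          rw [abs_le]
          have h1 := hr.lipschitz (d := d) fun x y hx hy ha => hT.lipschitz x hx y hy ha
          have h2 := hr.symm.lipschitz (d := d) fun x y hx hy ha => hT.lipschitz x hx y hy ha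
          constructor <;> linarith
        have h1 := hlip _ _ _ (hr1.mono hsub le_rfl)
        have h2 : |d u - d x| ≤ γ := by
          have hz : ∀ a b : V, ∀ l₁ l₂ : List V, Q = l₁ ++ a :: l₂ → b ∈ a :: l₂ →
              |d a - d b| ≤ γ := by
            intro a b l₁ l₂ heq hb
            rw [heq] at hQ hle
            exact hlip _ _ _ ((reach_of_chain hw (List.isChain_append.mp hQ).2.1
              (fun z hz => (hQW z (by rw [heq]; exact List.mem_append_right _ hz)).1) b hb).mono
              (fun _ => id) ((chainLen_suffix_le hw hQ).trans hle))
          obtain ⟨l₁, l₂, heq⟩ := List.append_of_mem hu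
          rcases List.mem_append.mp (heq ▸ hxQ) with h3 | h3
          · obtain ⟨l₃, l₄, rfl⟩ := List.append_of_mem h3
            rw [abs_sub_comm]
            exact hz x u l₃ (l₄ ++ u :: l₂) (by rw [heq]; simp) (by simp)
          · exact hz u x l₁ l₂ heq h3
        -- Even a vertex that joined by absorption has its centre in the skeleton: by `centre` it
        -- lies in `A ∪ T`, and the walk to it stays in `W`.
        have hft : f (f u) = f u := hr1.right.2.1
        have hfT : f u ∈ T := by
          by_cases huT : u ∈ T
          · rw [(hs u huT).2]; exact (hT.reach u huT).right.1
          · exact (h.centre u ⟨(hQW u hu).1, huT⟩ (.inl hus)).resolve_left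
              (he.disj.notMem_of_mem_right hfW)
        refine ⟨hfT, by rw [← (hs _ hfT).2, hft], ?_⟩
        calc |d (f u) - d x| ≤ |d (f u) - d u| + |d u - d x| := abs_sub_le _ _ _
          _ ≤ γ * (1 + r) + γ := add_le_add (by rw [abs_sub_comm]; exact h1) h2
          _ = γ * (2 + r) := by ring
      · rw [hxr] at hus ⊢
        by_contra hcon
        have huT : u ∉ T := fun h' => hus (hs u h').1
        have hfar : ∀ l : List V, (u :: l).IsChain G.Adj → chainLen w (u :: l) ≤ γ →
            (∀ z ∈ u :: l, z ∈ Q) → x ∉ u :: l := by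
          intro l hl hll hlQ hxl
          exact (h.far root (.inl rfl) u l hl hll ⟨(hQW u hu).1, huT⟩
            (fun h' => h'.elim hus (hQW u hu).2) hcon (fun z hz =>
              ⟨by rw [hA]; exact .inr (hQW z (hlQ z hz)).1, fun _ => by
                rw [hK]; exact (hQW z (hlQ z hz)).2⟩) x hxl).2 hxr
        -- The vertex `x` may come before or after `u`; in the first case the chain is run backwards
        -- from `u`.
        obtain ⟨l₁, l₂, heq⟩ := List.append_of_mem hu
        subst heq
        have hrev : (u :: l₁.reverse) = (l₁ ++ [u]).reverse := by simp
        have hpre : l₁ ++ u :: l₂ = (l₁ ++ [u]) ++ l₂ := by simp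
        rcases List.mem_append.mp hxQ with h3 | h3
        · refine hfar l₁.reverse ?_ ?_ (by simp; tauto) (by simp [h3])
          · rw [hrev, List.isChain_reverse]
            rw [hpre] at hQ
            exact (List.isChain_append.mp hQ).1.imp fun _ _ h => h.symm
          · rw [hrev, chainLen_reverse]
            rw [hpre] at hQ hle
            exact (chainLen_prefix_le hw hQ).trans hle
        · exact hfar l₂ (List.isChain_append.mp hQ).2.1 ((chainLen_suffix_le hw hQ).trans hle)
            (fun z hz => List.mem_append_right _ hz) h3
    · push Not at hx
      exact h.top Q hne hQ hle fun u hu =>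
        ⟨⟨(hQW u hu).1, fun h' => hx u hu (hs u h').1⟩, fun h' => h'.elim (hx u hu) (hQW u hu).2⟩
  · intro Z hZ v l hl hle hv hvL hZK hu
    have hvr : s v ≠ root := fun h' => hZK (by rw [h', hK]; exact hZ)
    have hvT : v ∉ T := fun h' => hvr (hs v h').1
    intro u hul
    have := h.far Z (.inr hZ) v l hl hle ⟨hv, hvT⟩ (fun h' => h'.elim hvr hvL) hZK
      (fun u hul => ⟨by rw [hA]; exact (hu u hul).1, fun h' => ?_⟩) u hul
    · exact ⟨this.1.1, this.2⟩
    · rcases h' with h' | h'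
      · rw [h']
        exact fun h'' => (he.older_notMem Z hZ).notMem_of_mem_left h'' hrW
      · exact (hu u hul).2 h'

theorem induce_connected_of_reach {C : Set V} (hne : C.Nonempty)
    (h : ∀ x ∈ C, ∀ y ∈ C, ∃ t, Reach G w (fun u => u ∈ C) x y t) : (G.induce C).Connected := by
  have key : ∀ x y t, Reach G w (fun u => u ∈ C) x y t → ∀ (hx : x ∈ C) (hy : y ∈ C),
      (G.induce C).Reachable ⟨x, hx⟩ ⟨y, hy⟩ := by
    intro x y t hr
    induction hr with
    | refl => exact fun _ _ => SimpleGraph.Reachable.refl _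
    | step hx ha hr _ ih =>
      intro hx hz
      exact (SimpleGraph.Adj.reachable (by simpa using ha)).trans (ih hr.left hz)
  have : Nonempty C := hne.to_subtype
  exact ⟨fun x y => by
    obtain ⟨t, ht⟩ := h x x.2 y y.2
    exact key _ _ _ ht x.2 y.2⟩

theorem Env.card_lt [Finite V] {A W L : Set V} {s f : V → V} {K : V → Set V}
    (he : Env G w r γ A W L s f K) (hG : CliqueMinorFree r G) : L.ncard < r := by
  by_contra! hle
  rw [← Nat.card_coe_set_eq] at hle
  have := Fintype.ofFinite L
  rw [Nat.card_eq_fintype_card, ← Fintype.card_fin r] at hle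
  obtain ⟨g⟩ := Function.Embedding.nonempty_of_card_le hle
  refine hG ⟨fun i => {b | b ∈ A ∧ s b = g i}, fun i => ?_, fun i j hij => ?_, fun i j hij => ?_⟩
  · obtain ⟨hA, hs⟩ := he.alive _ (g i).2
    refine induce_connected_of_reach (w := w) ⟨g i, hA, hs⟩ fun x hx y hy => ?_
    obtain ⟨t, ht⟩ := he.conn x hx.1 (hx.2 ▸ (g i).2)
    obtain ⟨t', ht'⟩ := he.conn y hy.1 (hy.2 ▸ (g i).2)
    rw [hx.2] at ht
    rw [hy.2] at ht'
    exact ⟨_, ht.trans ht'.symm⟩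
  · rw [disjoint_left]
    exact fun b hb hb' => hij (g.injective (Subtype.ext (hb.2.symm.trans hb'.2)))
  · obtain ⟨x, hx, y, hy, h1, h2, h3⟩ := he.adj _ (g i).2 _ (g j).2 fun h =>
      hij (g.injective (Subtype.ext h))
    exact ⟨x, ⟨hx, h1⟩, y, ⟨hy, h2⟩, h3⟩

/-- `T` is a union of at most `r` root paths, cut where the level `⌊d / γ⌋` changes. A piece stays
within one level, hence is shorter than `γ`. A path has at most one net point per level, and a
window of radius `γ * (2 + r)` meets at most `2 * r + 5` levels. -/
theorem Env.exists_skeleton [Finite V] (hw : ∀ x y, G.Adj x y → 0 ≤ w s(x, y)) (hγ : 0 < γ)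
    {A W L : Set V} {s f : V → V} {K : V → Set V}
    (he : Env G w r γ A W L s f K) (hL : L.ncard < r) (hW : W.Nonempty)
    (hconn : ∀ C ⊆ W, C.Nonempty → C ≠ W → ∃ x ∈ C, ∃ y ∈ W, y ∉ C ∧ G.Adj x y)
    (htouch : ∀ X ∈ L, ∃ b ∈ A, s b = X ∧ ∃ v ∈ W, G.Adj b v) :
    ∃ root T c d, IsSkeleton G w r (r * (2 * r + 5)) γ A W L s root T c d := by
  classical
  obtain ⟨root, hroot⟩ := hW
  have hrL : root ∉ L := fun h => he.disj.notMem_of_mem_left (he.alive _ h).1 hroot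
  obtain ⟨B, d, p, n, hB, hfr⟩ := exists_forest hw {root} (W \ {root})
  have hBW : B = W := by
    have hsub : B ⊆ W := hB.subset.trans (by
      rw [union_sdiff_self]; exact union_subset (by simpa using hroot) subset_rfl)
    by_contra hne
    obtain ⟨x, hx, y, hy, hyB, ha⟩ := hconn B hsub ⟨root, hB.source_subset rfl⟩ hne
    exact hyB (hfr x hx y ⟨hy, fun h => hyB (hB.source_subset h)⟩ ha)
  subst hBW
  obtain ⟨a, ha⟩ : ∃ a : V → V, ∀ X ∈ L, a X ∈ B ∧ ∃ b ∈ A, s b = X ∧ G.Adj b (a X) := by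
    have : ∀ X, ∃ v, X ∈ L → v ∈ B ∧ ∃ b ∈ A, s b = X ∧ G.Adj b v := by
      intro X
      by_cases hX : X ∈ L
      · obtain ⟨b, hb, h1, v, hv, h2⟩ := htouch X hX
        exact ⟨v, fun _ => ⟨hv, b, hb, h1, h2⟩⟩
      · exact ⟨X, fun h => absurd h hX⟩
    choose a ha using this
    exact ⟨a, ha⟩
  set q : V → V := fun v => if v = root then root else p v with hq
  have hqr : q root = root := by simp [hq]
  have hqp : ∀ v, v ≠ root → q v = p v := fun v hv => by simp [hq, hv]
  have hpar : ∀ v ∈ B, v ≠ root →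
      p v ∈ B ∧ G.Adj (p v) v ∧ d v = d (p v) + w s(p v, v) ∧ n (p v) < n v :=
    fun v hv hvr => hB.parent v hv hvr
  have hqB : ∀ v ∈ B, q v ∈ B ∧ d (q v) ≤ d v := by
    intro v hv
    by_cases hvr : v = root
    · rw [hvr, hqr]; exact ⟨hroot, le_rfl⟩
    · rw [hqp v hvr]
      obtain ⟨h1, h2, h3, -⟩ := hpar v hv hvr
      exact ⟨h1, by linarith [hw _ _ h2]⟩
  have hqk : ∀ k, ∀ v ∈ B, q^[k] v ∈ B ∧ d (q^[k] v) ≤ d v := by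
    intro k
    induction k with
    | zero => exact fun v hv => ⟨hv, le_rfl⟩
    | succ k ih =>
      intro v hv
      rw [Function.iterate_succ_apply]
      have := hqB v hv
      exact ⟨(ih _ this.1).1, (ih _ this.1).2.trans this.2⟩
  set a' : V → V := fun X => if X = root then root else a X with ha'
  have haB : ∀ X ∈ insert root L, a' X ∈ B := by
    intro X hX
    by_cases hXr : X = root
    · simpa [ha', hXr] using hroot
    · simpa [ha', hXr] using (ha X (hX.resolve_left hXr)).1
  set T : Set V := {v | ∃ X ∈ insert root L, ∃ k, q^[k] (a' X) = v} with hTdef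
  have hTB : T ⊆ B := by
    rintro v ⟨X, hX, k, rfl⟩
    exact (hqk k _ (haB X hX)).1
  have hTq : ∀ v ∈ T, v ≠ root → p v ∈ T := by
    rintro v ⟨X, hX, k, rfl⟩ hne
    exact ⟨X, hX, k + 1, by rw [Function.iterate_succ_apply', hqp _ hne]⟩
  set C : Set V := {v | v = root ∨ v ∉ B ∨ ⌊d (p v) / γ⌋ ≠ ⌊d v / γ⌋} with hC
  have hCn : ∀ v ∉ C, v ≠ root ∧ v ∈ B ∧ ⌊d (p v) / γ⌋ = ⌊d v / γ⌋ := by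
    intro v hv
    simpa [hC, not_or] using hv
  obtain ⟨c, hc, hc', hcC⟩ := exists_retract p n C fun v hv => by
    obtain ⟨h1, h2, -⟩ := hCn v hv
    exact (hpar v h2 h1).2.2.2
  have hnet : ∀ m, ∀ v ∈ T, n v = m →
      Reach G w (fun u => u ∈ T ∧ c u = c v) v (c v) (d v - d (c v)) ∧
        ⌊d (c v) / γ⌋ = ⌊d v / γ⌋ := by
    intro m
    induction m using Nat.strong_induction_on with
    | _ m ih =>
      intro v hv hm
      by_cases hvC : v ∈ C
      · rw [hc v hvC]
        exact ⟨.refl ⟨hv, hc v hvC⟩ (by simp), rfl⟩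
      · obtain ⟨h1, h2, h3⟩ := hCn v hvC
        obtain ⟨h4, h5, h6, h7⟩ := hpar v h2 h1
        obtain ⟨h8, h9⟩ := ih _ (hm ▸ h7) (p v) (hTq v hv h1) rfl
        rw [hc' v hvC]
        exact ⟨.step ⟨hv, hc' v hvC⟩ h5.symm h8 (by rw [Sym2.eq_swap]; linarith), h9.trans h3⟩
  refine ⟨root, T, c, d, hTB, ⟨root, .inl rfl, 0, by simp [ha']⟩, ?_, ?_, ?_, ?_, ?_⟩
  · intro v hv
    have : ∀ m, ∀ v ∈ T, n v = m → ∃ t, Reach G w (fun u => u ∈ T) v root t := by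
      intro m
      induction m using Nat.strong_induction_on with
      | _ m ih =>
        intro v hv hm
        by_cases hvr : v = root
        · exact ⟨0, hvr ▸ .refl hv le_rfl⟩
        · obtain ⟨h4, h5, h6, h7⟩ := hpar v (hTB hv) hvr
          obtain ⟨t, ht⟩ := ih _ (hm ▸ h7) (p v) (hTq v hv hvr) rfl
          exact ⟨_, .step hv h5.symm ht le_rfl⟩
    exact this _ v hv rfl
  · intro X hX
    obtain ⟨-, b, hb, h1, h2⟩ := ha X hX
    have hXr : X ≠ root := fun h => hrL (h ▸ hX)
    exact ⟨b, hb, a X, ⟨X, .inr hX, 0, by simp [ha', hXr]⟩, h1, h2⟩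
  · intro v hv
    obtain ⟨h1, h2⟩ := hnet _ v hv rfl
    refine h1.mono (fun _ => id) ?_
    have h3 := Int.abs_sub_lt_one_of_floor_eq_floor h2
    rw [← sub_div, abs_div, abs_of_pos hγ, div_lt_one hγ, abs_sub_comm] at h3
    exact (le_abs_self _).trans h3.le
  · intro x hx y hy hxy
    by_cases hxr : x = root
    · rw [hB.source x hxr]
      exact add_nonneg (hB.nonneg y hy) (hw _ _ hxy)
    · rw [Sym2.eq_swap]
      exact hB.lipschitz y hy x hx ⟨hx, hxr⟩ hxy.symm
  · intro x
    -- The parent of a net point other than the root is on a strictly lower level, and levels never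
    -- rise towards the root.
    have hchain : ∀ t ∈ T, c t = t → ∀ j, ⌊d (q^[j] t) / γ⌋ = ⌊d t / γ⌋ → q^[j] t = t := by
      intro t ht hct j hj
      by_cases htr : t = root
      · rw [htr]
        exact Function.iterate_fixed hqr j
      · cases j with
        | zero => rfl
        | succ j =>
          have htC : t ∈ C := hct ▸ hcC t
          have h1 : ⌊d (p t) / γ⌋ ≠ ⌊d t / γ⌋ :=
            (htC.resolve_left htr).resolve_left (not_not.mpr (hTB ht))
          rw [Function.iterate_succ_apply, hqp t htr] at hj
          have h2 := (hqB t (hTB ht)).2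
          rw [hqp t htr] at h2
          have h3 := (hqk j (p t) (hpar t (hTB ht) htr).1).2
          refine absurd (le_antisymm (Int.floor_le_floor (by gcongr)) ?_) h1
          rw [← hj]
          exact Int.floor_le_floor (by gcongr)
    have hex : ∀ t, ∃ X, t ∈ T → X ∈ insert root L ∧ ∃ k, q^[k] (a' X) = t := by
      intro t
      by_cases ht : t ∈ T
      · obtain ⟨X, hX, k⟩ := ht
        exact ⟨X, fun _ => ⟨hX, k⟩⟩
      · exact ⟨t, fun h => absurd h ht⟩
    choose g hg using hex
    set m : ℤ := ⌊x / γ⌋ with hm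
    -- A net point is determined by a root path through it and its level: of two points on one path,
    -- one is an ancestor of the other, and `hchain` identifies them.
    calc _ ≤ (insert root L ×ˢ (Icc (m - (2 + r)) (m + (2 + r)) : Set ℤ)).ncard := by
          refine ncard_le_ncard_of_injOn (fun t => (g t, ⌊d t / γ⌋)) ?_ ?_
            ((toFinite _).prod (finite_Icc _ _))
          · rintro t ⟨ht, -, hd⟩
            rw [abs_le] at hd
            refine ⟨(hg t ht).1, ?_, ?_⟩
            · have h1 : x / γ - ((2 + r : ℕ) : ℝ) ≤ d t / γ := by
                rw [sub_le_iff_le_add, div_le_iff₀ hγ, add_mul, div_mul_cancel₀ _ hγ.ne']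
                push_cast; linarith
              have := Int.floor_le_floor h1
              rw [Int.floor_sub_natCast] at this
              push_cast at this; exact this
            · have h1 : d t / γ ≤ x / γ + ((2 + r : ℕ) : ℝ) := by
                rw [div_le_iff₀ hγ, add_mul, div_mul_cancel₀ _ hγ.ne']
                push_cast; linarith
              have := Int.floor_le_floor h1
              rw [Int.floor_add_natCast] at this
              push_cast at this; exact this
          · rintro t ⟨ht, hct, -⟩ t' ⟨ht', hct', -⟩ heq
            simp only [Prod.mk.injEq] at heq
            obtain ⟨h1, h2⟩ := heq
            obtain ⟨-, k, hk⟩ := hg t ht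
            obtain ⟨-, k', hk'⟩ := hg t' ht'
            rw [← h1] at hk'
            rcases le_total k k' with hle | hle
            · obtain ⟨j, rfl⟩ := Nat.exists_eq_add_of_le' hle
              rw [Function.iterate_add_apply, hk] at hk'
              rw [← hk']
              exact (hchain t ht hct j (by rw [hk', h2])).symm
            · obtain ⟨j, rfl⟩ := Nat.exists_eq_add_of_le' hle
              rw [Function.iterate_add_apply, hk'] at hk
              rw [← hk]
              exact hchain t' ht' hct' j (by rw [hk, h2])
      _ ≤ r * (2 * r + 5) := by
          rw [ncard_prod]
          refine Nat.mul_le_mul ((ncard_insert_le _ _).trans hL) ?_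
          rw [ncard_eq_toFinset_card', toFinset_Icc, Int.card_Icc]
          omega

/-! ### The recursion. -/

theorem exists_sol [Finite V] (hw : ∀ x y, G.Adj x y → 0 ≤ w s(x, y)) (hγ : 0 < γ)
    (hG : CliqueMinorFree r G) (m : ℕ) :
    ∀ (A W L : Set V) (s f : V → V) (K : V → Set V), 2 * W.ncard + L.ncard = m →
      Env G w r γ A W L s f K →
      ∃ (s' f' : V → V) (K' : V → Set V), (∀ b ∈ A, s' b = s b ∧ f' b = f b ∧ K' b = K b) ∧
        Sol G w r (r * (2 * r + 5)) γ A W L s' f' K' := by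
  classical
  -- The weight `2` on `W.ncard` pays for creation, which removes at least the root from `W` and
  -- adds it to `L`. Splitting shrinks `W`, and retirement shrinks `L`.
  induction m using Nat.strong_induction_on with
  | _ m ih =>
    intro A W L s f K hm he
    rcases W.eq_empty_or_nonempty with rfl | hW
    · refine ⟨s, f, K, fun _ _ => ⟨rfl, rfl, rfl⟩, by simp, by simp, by simp, by simp, ?_, by simp⟩
      intro Q hne _ _ hQ
      obtain ⟨v, l, rfl⟩ := List.exists_cons_of_ne_nil hne
      exact absurd (hQ v (by simp)).1 (notMem_empty v)
    by_cases htouch : ∀ X ∈ L, ∃ b ∈ A, s b = X ∧ ∃ v ∈ W, G.Adj b v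
    · by_cases hconn : ∀ C ⊆ W, C.Nonempty → C ≠ W → ∃ x ∈ C, ∃ y ∈ W, y ∉ C ∧ G.Adj x y
      · have hL := he.card_lt hG
        obtain ⟨root, T, c, d, hT⟩ := he.exists_skeleton hw hγ hL hW hconn htouch
        have hTA : ∀ b ∈ A, b ∉ T := fun b hb h => he.disj.notMem_of_mem_left hb (hT.subset h)
        have hrA : ∀ b ∈ A, b ≠ root := fun b hb h => hTA b hb (h ▸ hT.root_mem)
        set s₁ : V → V := fun v => if v ∈ T then root else s v with hs₁
        set f₁ : V → V := fun v => if v ∈ T then c v else f v with hf₁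
        set K₁ : V → Set V := Function.update K root L with hK₁
        have hag : ∀ b ∈ A, s₁ b = s b ∧ f₁ b = f b ∧ K₁ b = K b := fun b hb =>
          ⟨if_neg (hTA b hb), if_neg (hTA b hb), Function.update_of_ne (hrA b hb) _ _⟩
        have hT' : ∀ s' : V → V, (∀ b ∈ A, s' b = s b) →
            IsSkeleton G w r (r * (2 * r + 5)) γ A W L s' root T c d := fun s' hs' =>
          ⟨hT.subset, hT.root_mem, hT.conn, fun X hX => by
            obtain ⟨b, hb, a, ha, h1, h2⟩ := hT.touch X hX
            exact ⟨b, hb, a, ha, by rw [hs' b hb, h1], h2⟩, hT.reach, hT.lipschitz, hT.count⟩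
        have he₁ := (he.congr hag).create hγ.le (hT' s₁ fun b hb => (hag b hb).1) hL
          (Function.update_self _ _ _) fun v hv => ⟨if_pos hv, if_pos hv⟩
        have hlt : (W \ T).ncard < W.ncard := ncard_lt_ncard
          ⟨sdiff_subset, fun h => (h (hT.subset hT.root_mem)).2 hT.root_mem⟩
        have hle := ncard_insert_le root L
        obtain ⟨s', f', K', hag', hsol⟩ := ih _ (by omega) _ _ _ _ _ _ rfl he₁
        have hag'' : ∀ b ∈ A, s' b = s b ∧ f' b = f b ∧ K' b = K b := fun b hb => by
          rw [(hag' b (.inl hb)).1, (hag' b (.inl hb)).2.1, (hag' b (.inl hb)).2.2]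
          exact hag b hb
        refine ⟨s', f', K', hag'', ?_⟩
        refine Sol.of_create hw hγ.le (he.congr hag'') (hT' s' fun b hb => (hag'' b hb).1) hL ?_ ?_
          hsol
        · rw [(hag' root (.inr hT.root_mem)).2.2]; exact Function.update_self _ _ _
        · intro v hv
          rw [(hag' v (.inr hv)).1, (hag' v (.inr hv)).2.1]
          exact ⟨if_pos hv, if_pos hv⟩
      · push Not at hconn
        obtain ⟨C, hCW, hC, hne, hcut⟩ := hconn
        have hcC : ∀ b ∈ W, b ∉ C → ∀ v ∈ C, ¬ G.Adj b v := fun b hb hbC v hv ha =>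
          hcut v hv b hb hbC ha.symm
        have hcD : ∀ b ∈ W, b ∉ W \ C → ∀ v ∈ W \ C, ¬ G.Adj b v := fun b hb hbC v hv ha => by
          have hbC' : b ∈ C := by by_contra h; exact hbC ⟨hb, h⟩
          exact hcut b hbC' v hv.1 hv.2 ha
        have hlt : C.ncard < W.ncard := ncard_lt_ncard (hCW.ssubset_of_ne hne)
        have hlt' : (W \ C).ncard < W.ncard := by
          obtain ⟨x, hx⟩ := hC
          exact ncard_lt_ncard ⟨sdiff_subset, fun h => (h (hCW hx)).2 hx⟩
        obtain ⟨s₁, f₁, K₁, hag₁, h₁⟩ := ih _ (by omega) _ _ _ _ _ _ rfl (he.mono_right hCW hcC)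
        obtain ⟨s₂, f₂, K₂, hag₂, h₂⟩ := ih _ (by omega) _ _ _ _ _ _ rfl
          (he.mono_right sdiff_subset hcD)
        set s' : V → V := fun v => if v ∈ C then s₁ v else s₂ v with hs'
        set f' : V → V := fun v => if v ∈ C then f₁ v else f₂ v with hf'
        set K' : V → Set V := fun v => if v ∈ C then K₁ v else K₂ v with hK'
        have hAC : ∀ b ∈ A, b ∉ C := fun b hb h => he.disj.notMem_of_mem_left hb (hCW h)
        have hag : ∀ b ∈ A, s' b = s b ∧ f' b = f b ∧ K' b = K b := fun b hb => by
          simp only [hs', hf', hK', if_neg (hAC b hb)]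
          exact hag₂ b hb
        have e₁ : ∀ v ∈ A ∪ C, s' v = s₁ v ∧ f' v = f₁ v ∧ K' v = K₁ v := by
          rintro v (hv | hv)
          · rw [(hag v hv).1, (hag v hv).2.1, (hag v hv).2.2, (hag₁ v hv).1, (hag₁ v hv).2.1,
              (hag₁ v hv).2.2]
            exact ⟨rfl, rfl, rfl⟩
          · exact ⟨if_pos hv, if_pos hv, if_pos hv⟩
        have e₂ : ∀ v ∈ A ∪ (W \ C), s' v = s₂ v ∧ f' v = f₂ v ∧ K' v = K₂ v := by
          rintro v (hv | hv)
          · rw [(hag v hv).1, (hag v hv).2.1, (hag v hv).2.2, (hag₂ v hv).1, (hag₂ v hv).2.1,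
              (hag₂ v hv).2.2]
            exact ⟨rfl, rfl, rfl⟩
          · exact ⟨if_neg hv.2, if_neg hv.2, if_neg hv.2⟩
        refine ⟨s', f', K', hag, Sol.of_split (C := C) (D := W \ C) hw (he.congr hag)
          (union_sdiff_cancel hCW).symm (fun b hb v hv => hcut b hb v hv.1 hv.2)
          (h₁.congr (fun X hX => (he.alive X hX).1) e₁)
          (h₂.congr (fun X hX => (he.alive X hX).1) e₂)⟩
    · push Not at htouch
      obtain ⟨X, hX, hna⟩ := htouch
      obtain ⟨R, c, hR⟩ := he.exists_buffer hw hX hna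
      have hRA : ∀ b ∈ A, b ∉ R := fun b hb h => he.disj.notMem_of_mem_left hb (hR.subset h)
      set s₁ : V → V := fun v => if v ∈ R then s (c v) else s v with hs₁
      set f₁ : V → V := fun v => if v ∈ R then f (c v) else f v with hf₁
      have hag : ∀ b ∈ A, s₁ b = s b ∧ f₁ b = f b ∧ K b = K b := fun b hb =>
        ⟨if_neg (hRA b hb), if_neg (hRA b hb), rfl⟩
      have hs : ∀ v ∈ R, s₁ v = s₁ (c v) ∧ f₁ v = f₁ (c v) := fun v hv => by
        rw [(hag _ (hR.source v hv).1).1, (hag _ (hR.source v hv).1).2.1]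
        exact ⟨if_pos hv, if_pos hv⟩
      have he₁ := (he.congr hag).absorb hγ.le hX
        (fun b hb h => hna b hb (by rw [← (hag b hb).1, h]))
        (hR.congr he hX fun b hb => ⟨(hag b hb).1, rfl⟩) hs
      have hlt := ncard_sdiff_singleton_lt_of_mem hX
      have hle : (W \ R).ncard ≤ W.ncard := ncard_le_ncard sdiff_subset
      obtain ⟨s', f', K', hag', hsol⟩ := ih _ (by omega) _ _ _ _ _ _ rfl he₁
      have hag'' : ∀ b ∈ A, s' b = s b ∧ f' b = f b ∧ K' b = K b := fun b hb => by
        rw [(hag' b (.inl hb)).1, (hag' b (.inl hb)).2.1, (hag' b (.inl hb)).2.2]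
        exact hag b hb
      refine ⟨s', f', K', hag'', Sol.of_absorb hγ.le (he.congr hag'') hX
        (hR.congr he hX fun b hb => ⟨(hag'' b hb).1, (hag'' b hb).2.2⟩) (fun v hv => ?_) hsol⟩
      have h1 := hag' v (.inr hv)
      have h2 := hag' (c v) (.inl (hR.source v hv).1)
      rw [h1.1, h1.2.1, h2.1, h2.2.1]
      exact hs v hv

/-- A weighted graph without `K_r` minor has a partition into clusters, given by the map `f` to the
cluster centres, that is grouped into supernodes by the map `s`. -/
theorem exists_decomposition [Finite V] (hw : ∀ x y, G.Adj x y → 0 ≤ w s(x, y)) (hγ : 0 < γ)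
    (hG : CliqueMinorFree r G) :
    ∃ (s f : V → V) (K : V → Set V),
      (∀ v, Reach G w (fun u => f u = f v) v (f v) (γ * (1 + r))) ∧
      (∀ v, (K (s v)).ncard ≤ r) ∧
      ∀ Q : List V, Q ≠ [] → Q.IsChain G.Adj → chainLen w Q ≤ γ →
        ∃ x ∈ Q, (∃ T : Set V, T.ncard ≤ r * (2 * r + 5) ∧ ∀ u ∈ Q, s u = s x → f u ∈ T) ∧
          ∀ u ∈ Q, s u ≠ s x → s x ∈ K (s u) := by
  obtain ⟨s, f, K, -, h⟩ := exists_sol (r := r) hw hγ hG _ ∅ univ ∅ id id (fun _ => ∅) rfl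
    ⟨by simp, by simp, by simp, by simp, by simp, by simp, by simp, by simp, by simp, by simp⟩
  refine ⟨s, f, K, fun v => (h.rad v trivial).mono (fun u hu => hu.2.1) le_rfl,
    fun v => h.card_le v trivial (by simp), fun Q hne hQ hle => h.top Q hne hQ hle (by simp)⟩

end Decomposition

/-! ### From the decomposition to hop bounds. -/

section Hops

variable {V Λ : Type*} {G : SimpleGraph V} {w : Sym2 V → ℝ} {γ : ℝ} {Γ : SimpleGraph Λ} {cl : V → Λ}

/-- The clusters of the first and the last vertex of `P` are joined by a walk of length at most `N`
in the graph `Γ` of clusters that visits only clusters meeting `P`. -/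
def HasHops (Γ : SimpleGraph Λ) (cl : V → Λ) (N : ℕ) (P : List V) : Prop :=
  ∀ h : P ≠ [], ∃ q : Γ.Walk (cl (P.head h)) (cl (P.getLast h)), q.length ≤ N ∧
    ∀ C ∈ q.support, ∃ x ∈ P, cl x = C

theorem HasHops.mono {N N' : ℕ} {P : List V} (h : HasHops Γ cl N P) (hN : N ≤ N') :
    HasHops Γ cl N' P := fun hne => by
  obtain ⟨q, h1, h2⟩ := h hne
  exact ⟨q, h1.trans hN, h2⟩

theorem hasHops_zero {P : List V} (h : ∀ hne : P ≠ [], cl (P.head hne) = cl (P.getLast hne)) :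
    HasHops Γ cl 0 P := fun hne =>
  ⟨SimpleGraph.Walk.nil.copy rfl (h hne), by simp, fun C hC => by
    simp only [SimpleGraph.Walk.support_copy, SimpleGraph.Walk.support_nil,
      List.mem_singleton] at hC
    exact ⟨_, List.head_mem hne, hC.symm⟩⟩

theorem HasHops.append (hΓ : ∀ x y, G.Adj x y → cl x ≠ cl y → Γ.Adj (cl x) (cl y))
    {N N' : ℕ} {P Q : List V} (hP : HasHops Γ cl N P) (hQ : HasHops Γ cl N' Q)
    (h : (P ++ Q).IsChain G.Adj) : HasHops Γ cl (N + N' + 1) (P ++ Q) := by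
  rcases eq_or_ne P [] with rfl | hPne
  · simpa using hQ.mono (by omega)
  rcases eq_or_ne Q [] with rfl | hQne
  · simpa using hP.mono (by omega)
  intro hne
  obtain ⟨q, h1, h2⟩ := hP hPne
  obtain ⟨q', h3, h4⟩ := hQ hQne
  have hadj : G.Adj (P.getLast hPne) (Q.head hQne) :=
    (List.isChain_append.mp h).2.2 _ (List.getLast_mem_getLast? hPne) _ (List.head_mem_head? hQne)
  have hedge : ∃ e : Γ.Walk (cl (P.getLast hPne)) (cl (Q.head hQne)), e.length ≤ 1 ∧
      ∀ C ∈ e.support, C = cl (P.getLast hPne) ∨ C = cl (Q.head hQne) := by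
    by_cases heq : cl (P.getLast hPne) = cl (Q.head hQne)
    · exact ⟨SimpleGraph.Walk.nil.copy rfl heq, by simp, by simp⟩
    · exact ⟨(hΓ _ _ hadj heq).toWalk, by simp, by simp⟩
  obtain ⟨e, h5, h6⟩ := hedge
  refine ⟨(q.append (e.append q')).copy (by rw [List.head_append_of_ne_nil])
    (by rw [List.getLast_append_of_ne_nil _ hQne]), ?_, ?_⟩
  · simp only [SimpleGraph.Walk.length_copy, SimpleGraph.Walk.length_append]; omega
  · intro C hC
    simp only [SimpleGraph.Walk.support_copy, SimpleGraph.Walk.mem_support_append_iff] at hC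
    rcases hC with hC | hC | hC
    · obtain ⟨x, hx, h⟩ := h2 C hC
      exact ⟨x, List.mem_append_left _ hx, h⟩
    · rcases h6 C hC with h | h
      · exact ⟨_, List.mem_append_left _ (List.getLast_mem hPne), h.symm⟩
      · exact ⟨_, List.mem_append_right _ (List.head_mem hQne), h.symm⟩
    · obtain ⟨x, hx, h⟩ := h4 C hC
      exact ⟨x, List.mem_append_right _ hx, h⟩

theorem exists_first_split (p : V → Prop) : ∀ l : List V, (∃ x ∈ l, p x) →
    ∃ l₁ x l₂, l = l₁ ++ x :: l₂ ∧ p x ∧ ∀ u ∈ l₁, ¬ p u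
  | [], h => by simp at h
  | a :: l, h => by
    by_cases ha : p a
    · exact ⟨[], a, l, rfl, ha, by simp⟩
    · obtain ⟨l₁, x, l₂, h1, h2, h3⟩ := exists_first_split p l (by simpa [ha] using h)
      exact ⟨a :: l₁, x, l₂, by rw [h1]; rfl, h2, by simpa using ⟨ha, h3⟩⟩

theorem exists_last_split (p : V → Prop) (l : List V) (h : ∃ x ∈ l, p x) :
    ∃ l₁ x l₂, l = l₁ ++ x :: l₂ ∧ p x ∧ ∀ u ∈ l₂, ¬ p u := by
  obtain ⟨l₁, x, l₂, h1, h2, h3⟩ := exists_first_split p l.reverse (by simpa using h)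
  exact ⟨l₂.reverse, x, l₁.reverse, by rw [← List.reverse_reverse l, h1]; simp, h2, by simpa using h3⟩

/-- Shortcutting a chain at the clusters of its vertices with property `p`. -/
theorem hasHops_of_few {Λ' : Type*} {f : V → Λ'}
    (hΓ : ∀ x y, G.Adj x y → cl x ≠ cl y → Γ.Adj (cl x) (cl y))
    (hcl : ∀ x y, f x = f y → cl x = cl y) (p : V → Prop) (N k : ℕ) :
    ∀ (P : List V) (T : Set Λ'), T.Finite → T.ncard ≤ k → P.IsChain G.Adj →
      (∀ u ∈ P, p u → f u ∈ T) →
      (∀ Q, Q <:+: P → (∀ u ∈ Q, ¬ p u) → HasHops Γ cl N Q) →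
      HasHops Γ cl (k * (N + 2) + N) P := by
  induction k with
  | zero =>
    intro P T hT hk _ hPT hQ
    have : T = ∅ := (ncard_eq_zero hT).mp (by omega)
    simpa using hQ P List.infix_rfl fun u hu hpu => by simpa [this] using hPT u hu hpu
  | succ k ih =>
    intro P T hT hk hP hPT hQ
    by_cases hex : ∃ x ∈ P, p x
    · obtain ⟨P₁, x, P₂, rfl, hx, hP₁⟩ := exists_first_split p P hex
      -- Jumping from the first `p`-vertex `x` to the last vertex `y` of its cluster is free, and
      -- that cluster never recurs in `P₄`. The two connecting edges and `P₁` cost `N + 2`.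
      obtain ⟨P₃, y, P₄, h34, hy, hP₄⟩ := exists_last_split (fun u => f u = f x) (x :: P₂)
        ⟨x, by simp, rfl⟩
      have heq : P₁ ++ x :: P₂ = P₁ ++ ((P₃ ++ [y]) ++ P₄) := by rw [h34]; simp
      have hxy : HasHops Γ cl 0 (P₃ ++ [y]) := hasHops_zero fun hne => by
        have hhead : (P₃ ++ [y]).head hne = x := by
          cases P₃ with
          | nil => simp only [List.nil_append, List.cons.injEq] at h34; simp [h34.1]
          | cons a P₃ => simp only [List.cons_append, List.cons.injEq] at h34; simp [h34.1]
        rw [hhead, List.getLast_append_singleton]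
        exact hcl _ _ hy.symm
      have h4 : HasHops Γ cl (k * (N + 2) + N) P₄ := by
        refine ih P₄ (T \ {f x}) (hT.subset sdiff_subset) ?_ ?_ ?_ ?_
        · have := ncard_sdiff_singleton_add_one (hPT x (by simp) hx) hT
          omega
        · exact (List.isChain_append.mp (List.isChain_append.mp (heq ▸ hP)).2.1).2.1
        · intro u hu hpu
          exact ⟨hPT u (by rw [heq]; simp [hu]) hpu, hP₄ u hu⟩
        · intro Q hQP
          exact hQ Q (heq ▸ hQP.trans ⟨P₁ ++ (P₃ ++ [y]), [], by simp⟩)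
      have h1 : HasHops Γ cl N P₁ := hQ P₁ ⟨[], x :: P₂, by simp⟩ hP₁
      rw [heq] at hP ⊢
      exact (h1.append hΓ (hxy.append hΓ h4 (List.isChain_append.mp hP).2.1) hP).mono
        (by rw [Nat.add_mul]; omega)
    · push Not at hex
      exact (hQ P List.infix_rfl hex).mono (by omega)

theorem chainLen_infix_le (hw : ∀ x y, G.Adj x y → 0 ≤ w s(x, y)) {Q P : List V} (h : Q <:+: P)
    (hP : P.IsChain G.Adj) : chainLen w Q ≤ chainLen w P := by
  obtain ⟨l, l', rfl⟩ := h
  exact (chainLen_suffix_le hw (List.isChain_append.mp hP).1).trans (chainLen_prefix_le hw hP)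

/-- The hop bound for short chains, by recursion on the supernodes. -/
theorem hasHops_of_top {Λ' Λ'' : Type*} [Finite Λ'] [Finite Λ''] {f : V → Λ'} {s : V → Λ''}
    {K : Λ'' → Set Λ''} {r M : ℕ} (hw : ∀ x y, G.Adj x y → 0 ≤ w s(x, y))
    (hΓ : ∀ x y, G.Adj x y → cl x ≠ cl y → Γ.Adj (cl x) (cl y))
    (hcl : ∀ x y, f x = f y → cl x = cl y) (hK : ∀ v, (K (s v)).ncard ≤ r)
    (htop : ∀ Q : List V, Q ≠ [] → Q.IsChain G.Adj → chainLen w Q ≤ γ →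
      ∃ x ∈ Q, (∃ T : Set Λ', T.ncard ≤ M ∧ ∀ u ∈ Q, s u = s x → f u ∈ T) ∧
        ∀ u ∈ Q, s u ≠ s x → s x ∈ K (s u)) (m : ℕ) :
    ∀ (F : Set Λ'') (P : List V), F.ncard + m = r + 1 → P.IsChain G.Adj → chainLen w P ≤ γ →
      (∀ u ∈ P, F ⊆ K (s u) ∧ s u ∉ F) → HasHops Γ cl (2 * (M + 1) ^ m - 2) P := by
  induction m with
  | zero =>
    intro F P hF _ _ hPF hne
    -- Here `F` has `r + 1` elements, too many to fit into any `K (s u)`, so `P` must be empty.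
    have := ncard_le_ncard (hPF _ (List.head_mem hne)).1
    have := hK (P.head hne)
    omega
  | succ m ih =>
    intro F P hF hP hle hPF
    rcases eq_or_ne P [] with rfl | hne
    · exact fun h => absurd rfl h
    obtain ⟨x, hx, ⟨T, hTM, hT⟩, hxK⟩ := htop P hne hP hle
    have hN : 1 ≤ (M + 1) ^ m := Nat.one_le_pow _ _ (by omega)
    refine (hasHops_of_few hΓ hcl (fun u => s u = s x) (2 * (M + 1) ^ m - 2) M P T (toFinite _) hTM
      hP hT fun Q hQ hQx => ?_).mono ?_
    · have hsub : ∀ u ∈ Q, u ∈ P := fun u hu => hQ.subset hu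
      refine ih (insert (s x) F) Q ?_ ?_ ((chainLen_infix_le hw hQ hP).trans hle) fun u hu => ?_
      · rw [ncard_insert_of_notMem (hPF x hx).2]; omega
      · obtain ⟨l, l', rfl⟩ := hQ
        exact (List.isChain_append.mp (List.isChain_append.mp hP).1).2.1
      · refine ⟨insert_subset (hxK u (hsub u hu) (hQx u hu)) (hPF u (hsub u hu)).1, ?_⟩
        rintro (h | h)
        · exact hQx u hu h
        · exact (hPF u (hsub u hu)).2 h
    -- One level turns `N` into `M * (N + 2) + N`, that is, it multiplies `N + 2` by `M + 1`.
    · obtain ⟨a, ha⟩ := Nat.exists_eq_add_of_le hN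
      rw [pow_succ, ha]
      have h1 : 2 * (1 + a) - 2 = 2 * a := by omega
      rw [h1]
      apply Nat.le_sub_of_add_le
      apply le_of_eq
      ring

/-- Cutting a long chain greedily into short ones. -/
theorem hasHops_of_short {N : ℕ} (hγ : 0 ≤ γ)
    (hΓ : ∀ x y, G.Adj x y → cl x ≠ cl y → Γ.Adj (cl x) (cl y))
    (hshort : ∀ P : List V, P.IsChain G.Adj → chainLen w P ≤ γ → HasHops Γ cl N P) (k : ℕ) :
    ∀ P : List V, P.IsChain G.Adj → chainLen w P ≤ (k + 1) * γ →
      HasHops Γ cl ((k + 1) * (N + 1)) P := by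
  -- The edge into `z` may be arbitrarily long, but it costs a single hop; together with `P₁` it
  -- uses up more than `γ` of the length.
  have hcut : ∀ P : List V, γ < chainLen w P → ∃ P₁ z P₂, P = P₁ ++ z :: P₂ ∧
      chainLen w P₁ ≤ γ ∧ γ < chainLen w (P₁ ++ [z]) := by
    intro P
    induction P using List.reverseRecOn with
    | nil => intro h; exact absurd (hγ.trans_lt h) (by simp [chainLen])
    | append_singleton P z ih =>
      intro h
      rcases le_or_gt (chainLen w P) γ with h' | h'
      · exact ⟨P, z, [], rfl, h', h⟩
      · obtain ⟨P₁, y, P₂, h1, h2, h3⟩ := ih h'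
        exact ⟨P₁, y, P₂ ++ [z], by rw [h1]; simp, h2, h3⟩
  induction k with
  | zero => intro P hP hle; exact (hshort P hP (by simpa using hle)).mono (by omega)
  | succ k ih =>
    intro P hP hle
    rcases le_or_gt (chainLen w P) γ with h | h
    · exact (hshort P hP h).mono (by nlinarith)
    · obtain ⟨P₁, z, P₂, rfl, h1, h2⟩ := hcut P h
      rw [chainLen_append_cons] at hle
      push_cast at hle
      have hP' := List.isChain_append.mp hP
      exact ((hshort P₁ hP'.1 h1).append hΓ (ih _ hP'.2.1 (by linarith)) hP).mono (by
        rw [Nat.add_mul (k + 1)]; omega)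

end Hops

/-! ### Contracting the edges of weight zero. -/

section Quotient

variable {V : Type*} {G : SimpleGraph V} {w : Sym2 V → ℝ}

/-- The equivalence relation generated by the edges of weight zero. -/
def zeroSetoid (G : SimpleGraph V) (w : Sym2 V → ℝ) : Setoid V :=
  Relation.EqvGen.setoid fun x y => G.Adj x y ∧ w s(x, y) = 0

/-- The vertices of the graph with the edges of weight zero contracted. -/
abbrev ZeroQuot (G : SimpleGraph V) (w : Sym2 V → ℝ) : Type _ := Quotient (zeroSetoid G w)

/-- The projection to the contracted graph. -/
def zeroProj (G : SimpleGraph V) (w : Sym2 V → ℝ) (x : V) : ZeroQuot G w :=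
  Quotient.mk (zeroSetoid G w) x

/-- The graph with the edges of weight zero contracted. -/
def zeroGraph (G : SimpleGraph V) (w : Sym2 V → ℝ) : SimpleGraph (ZeroQuot G w) where
  Adj a b := a ≠ b ∧ ∃ x y, zeroProj G w x = a ∧ zeroProj G w y = b ∧ G.Adj x y
  symm := ⟨fun _ _ ⟨h, x, y, hx, hy, ha⟩ => ⟨h.symm, y, x, hy, hx, ha.symm⟩⟩
  loopless := ⟨fun _ h => h.1 rfl⟩

/-- The weight of an edge of the contracted graph: the least weight of a preimage. -/
noncomputable def zeroWeight (G : SimpleGraph V) (w : Sym2 V → ℝ) (e : Sym2 (ZeroQuot G w)) : ℝ :=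
  sInf {t | ∃ x y, G.Adj x y ∧ s(zeroProj G w x, zeroProj G w y) = e ∧ w s(x, y) = t}

theorem finite_zeroWeight_set [Finite V] (e : Sym2 (ZeroQuot G w)) :
    {t | ∃ x y, G.Adj x y ∧ s(zeroProj G w x, zeroProj G w y) = e ∧ w s(x, y) = t}.Finite :=
  (finite_range fun q : V × V => w s(q.1, q.2)).subset fun _ ⟨x, y, _, _, h⟩ => ⟨(x, y), h⟩

theorem zeroWeight_le [Finite V] {x y : V} (h : G.Adj x y) :
    zeroWeight G w s(zeroProj G w x, zeroProj G w y) ≤ w s(x, y) :=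
  csInf_le (finite_zeroWeight_set _).bddBelow ⟨x, y, h, rfl, rfl⟩

theorem exists_zeroWeight_eq [Finite V] {a b : ZeroQuot G w} (h : (zeroGraph G w).Adj a b) :
    ∃ x y, zeroProj G w x = a ∧ zeroProj G w y = b ∧ G.Adj x y ∧
      w s(x, y) = zeroWeight G w s(a, b) := by
  obtain ⟨-, x₀, y₀, rfl, rfl, h₀⟩ := h
  have hne : {t | ∃ x y, G.Adj x y ∧
      s(zeroProj G w x, zeroProj G w y) = s(zeroProj G w x₀, zeroProj G w y₀) ∧
        w s(x, y) = t}.Nonempty := ⟨_, x₀, y₀, h₀, rfl, rfl⟩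
  obtain ⟨x, y, ha, he, hxy⟩ := hne.csInf_mem (finite_zeroWeight_set _)
  rcases Sym2.eq_iff.mp he with ⟨h1, h2⟩ | ⟨h1, h2⟩
  · exact ⟨x, y, h1, h2, ha, hxy⟩
  · exact ⟨y, x, h2, h1, ha.symm, by rw [Sym2.eq_swap, hxy]; rfl⟩

theorem zeroWeight_nonneg [Finite V] (hw : ∀ x y, G.Adj x y → 0 ≤ w s(x, y))
    (a b : ZeroQuot G w) (h : (zeroGraph G w).Adj a b) : 0 ≤ zeroWeight G w s(a, b) := by
  obtain ⟨x, y, -, -, ha, he⟩ := exists_zeroWeight_eq h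
  exact he ▸ hw x y ha

theorem reach_of_zeroProj_eq {x y : V} (h : zeroProj G w x = zeroProj G w y) :
    Reach G w (fun u => zeroProj G w u = zeroProj G w x) x y 0 := by
  have h' : Relation.EqvGen (fun x y => G.Adj x y ∧ w s(x, y) = 0) x y := Quotient.exact h
  clear h
  induction h' with
  | rel x y hxy =>
    have hy : zeroProj G w y = zeroProj G w x :=
      (Quotient.sound (s := zeroSetoid G w) (Relation.EqvGen.rel _ _ hxy)).symm
    exact .step rfl hxy.1 (.refl hy le_rfl) (by rw [hxy.2]; simp)
  | refl x => exact .refl rfl le_rfl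
  | symm x y _ ih =>
    refine ih.symm.mono (fun u hu => ?_) le_rfl
    rw [hu, ih.right]
  | trans x y z _ _ ih₁ ih₂ =>
    refine (ih₁.trans (ih₂.mono (fun u hu => ?_) le_rfl)).mono (fun _ => id) (by simp)
    rw [hu, ih₁.right]

/-- Walks of the contracted graph lift. -/
theorem reach_of_zeroGraph [Finite V] {Z : ZeroQuot G w → Prop} {a b : ZeroQuot G w} {t : ℝ}
    (h : Reach (zeroGraph G w) (zeroWeight G w) Z a b t) :
    ∀ x y, zeroProj G w x = a → zeroProj G w y = b →
      Reach G w (fun u => Z (zeroProj G w u)) x y t := by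
  induction h with
  | refl hZ h0 =>
    rintro x y rfl hy
    exact (reach_of_zeroProj_eq hy.symm).mono (fun u hu => by rwa [hu]) h0
  | step hZ hadj _ hle ih =>
    rintro x y rfl hy
    obtain ⟨x', y', hx', hy', ha, he⟩ := exists_zeroWeight_eq hadj
    have h1 := (reach_of_zeroProj_eq hx'.symm).mono
      (Z' := fun u => Z (zeroProj G w u)) (fun u hu => by rwa [hu]) le_rfl
    have h2 : Reach G w (fun u => Z (zeroProj G w u)) x' y _ :=
      .step (by rwa [hx']) ha (ih y' y hy' hy) le_rfl
    exact (h1.trans h2).mono (fun _ => id) (by rw [he]; linarith)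

theorem reach_of_induce_reachable {C : Set V} {x y : C} (h : (G.induce C).Reachable x y) :
    ∃ t, Reach G w (fun u => u ∈ C) x y t := by
  obtain ⟨p⟩ := h
  induction p with
  | nil => exact ⟨0, .refl (Subtype.prop _) le_rfl⟩
  | cons ha _ ih =>
    obtain ⟨t, ht⟩ := ih
    exact ⟨_, .step (Subtype.prop _) (by simpa using ha) ht le_rfl⟩

/-- Preimages of branch sets are again branch sets: they are connected because each contracted class
is. -/
theorem CliqueMinorFree.zeroGraph [Finite V] {r : ℕ} (hG : CliqueMinorFree r G) :
    CliqueMinorFree r (zeroGraph G w) := by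
  rintro ⟨B, hB, hd, ha⟩
  refine hG ⟨fun i => zeroProj G w ⁻¹' B i, fun i => ?_, fun i j hij => (hd i j hij).preimage _,
    fun i j hij => ?_⟩
  · obtain ⟨⟨z, hz⟩⟩ := (hB i).nonempty
    obtain ⟨x₀, rfl⟩ := Quotient.exists_rep z
    refine induce_connected_of_reach (w := w) ⟨x₀, hz⟩ fun x hx y hy => ?_
    obtain ⟨t, ht⟩ := reach_of_induce_reachable (w := zeroWeight G w)
      ((hB i).preconnected ⟨_, hx⟩ ⟨_, hy⟩)
    exact ⟨t, reach_of_zeroGraph ht x y rfl rfl⟩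
  · obtain ⟨a, hai, b, hbj, -, x, y, rfl, rfl, hxy⟩ := ha i j hij
    exact ⟨x, hai, y, hbj, hxy⟩

/-- Chains project to the contracted graph. -/
theorem exists_zeroGraph_chain [Finite V] (hw : ∀ x y, G.Adj x y → 0 ≤ w s(x, y)) :
    ∀ (l : List V) (v : V), (v :: l).IsChain G.Adj → ∃ l' : List (ZeroQuot G w),
      (zeroProj G w v :: l').IsChain (zeroGraph G w).Adj ∧
      chainLen (zeroWeight G w) (zeroProj G w v :: l') ≤ chainLen w (v :: l) ∧
      ∀ z, z ∈ zeroProj G w v :: l' ↔ ∃ u ∈ v :: l, zeroProj G w u = z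
  | [], v, _ => ⟨[], by simp, le_rfl, by simp [eq_comm]⟩
  | a :: l, v, h => by
    rw [List.isChain_cons_cons] at h
    obtain ⟨l', h1, h2, h3⟩ := exists_zeroGraph_chain hw l a h.2
    by_cases heq : zeroProj G w v = zeroProj G w a
    · refine ⟨l', by rwa [heq], ?_, fun z => ?_⟩
      · rw [heq]
        have := hw _ _ h.1
        simp only [chainLen]; linarith
      · rw [heq, h3]
        simp only [List.mem_cons, exists_eq_or_imp, heq]
        tauto
    · refine ⟨zeroProj G w a :: l', ?_, ?_, fun z => ?_⟩
      · exact List.isChain_cons_cons.mpr ⟨⟨heq, v, a, rfl, rfl, h.1⟩, h1⟩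
      · have := zeroWeight_le (w := w) h.1
        simp only [chainLen]; linarith
      · rw [List.mem_cons, h3]
        simp [eq_comm]

theorem zeroProj_eq_of_wlen_eq_zero (hw : ∀ x y, G.Adj x y → 0 ≤ w s(x, y)) {u v : V}
    (p : G.Walk u v) (h : wlen w p = 0) : zeroProj G w u = zeroProj G w v := by
  have hnn : ∀ {u v : V} (p : G.Walk u v), 0 ≤ wlen w p := by
    intro u v p
    refine List.sum_nonneg fun t ht => ?_
    obtain ⟨e, he, rfl⟩ := List.mem_map.mp ht
    have := p.edges_subset_edgeSet he
    induction e with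
    | h x y => exact hw x y this
  induction p with
  | nil => rfl
  | @cons u v _ ha p ih =>
    have h1 : wlen w (.cons ha p) = w s(u, v) + wlen w p := by simp [wlen]
    have h2 := hnn p
    have h3 := hw _ _ ha
    have h4 : zeroProj G w u = zeroProj G w v := Quotient.sound (s := zeroSetoid G w)
      (Relation.EqvGen.rel _ _ ⟨ha, by linarith⟩)
    rw [h4]
    exact ih (by linarith)

end Quotient

/-! ### Lengths, diameters and the numerical estimate. -/

section Walks

variable {V : Type*} {G : SimpleGraph V} {w : Sym2 V → ℝ}

theorem wlen_nonneg (hw : ∀ e ∈ G.edgeSet, 0 ≤ w e) {u v : V} (p : G.Walk u v) : 0 ≤ wlen w p :=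
  List.sum_nonneg fun t ht => by
    obtain ⟨e, he, rfl⟩ := List.mem_map.mp ht
    exact hw e (p.edges_subset_edgeSet he)

theorem wdist_le (hw : ∀ e ∈ G.edgeSet, 0 ≤ w e) {u v : V} (p : G.Walk u v) :
    wdist G w u v ≤ wlen w p :=
  ciInf_le ⟨0, by rintro _ ⟨p, rfl⟩; exact wlen_nonneg hw p⟩ p

theorem wdist_nonneg (hw : ∀ e ∈ G.edgeSet, 0 ≤ w e) (u v : V) : 0 ≤ wdist G w u v :=
  Real.iInf_nonneg fun p => wlen_nonneg hw p

theorem wdist_le_wdiam [Finite V] (u v : V) : wdist G w u v ≤ wdiam G w :=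
  le_ciSup (f := fun q : V × V => wdist G w q.1 q.2) (finite_range _).bddAbove (u, v)

theorem wdiam_nonneg (hw : ∀ e ∈ G.edgeSet, 0 ≤ w e) : 0 ≤ wdiam G w :=
  Real.iSup_nonneg fun q => wdist_nonneg hw q.1 q.2

theorem chainLen_support {u v : V} (p : G.Walk u v) : chainLen w p.support = wlen w p := by
  induction p with
  | nil => simp [chainLen, wlen]
  | cons ha p ih =>
    rw [SimpleGraph.Walk.support_cons, ← p.cons_tail_support]
    rw [← p.cons_tail_support] at ih
    simp only [chainLen, ih]
    simp [wlen]

theorem exists_walk_of_reach {Z : V → Prop} {x y : V} {t : ℝ} (h : Reach G w Z x y t)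
    {C : Set V} (hZ : ∀ u, Z u → u ∈ C) : ∀ (hx : x ∈ C) (hy : y ∈ C),
      ∃ p : (G.induce C).Walk ⟨x, hx⟩ ⟨y, hy⟩, wlen (fun e => w (e.map Subtype.val)) p ≤ t := by
  induction h with
  | refl _ h0 => exact fun _ _ => ⟨.nil, by simpa [wlen] using h0⟩
  | @step x y z _ _ hx ha hr hle ih =>
    intro hxC hzC
    obtain ⟨p, hp⟩ := ih (hZ _ hr.left) hzC
    refine ⟨.cons (v := ⟨y, hZ _ hr.left⟩) (by simpa using ha) p, ?_⟩
    simp only [wlen, SimpleGraph.Walk.edges_cons, List.map_cons, List.sum_cons, Sym2.map_mk] at hp ⊢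
    linarith

theorem induce_weight_nonneg (hw : ∀ e ∈ G.edgeSet, 0 ≤ w e) (C : Set V) :
    ∀ e ∈ (G.induce C).edgeSet, 0 ≤ w (e.map Subtype.val) := by
  intro e he
  induction e with
  | h x y => exact hw _ (by simpa using he)

theorem strongDiam_le (hw : ∀ e ∈ G.edgeSet, 0 ≤ w e) {C : Set V} {t : ℝ} (ht : 0 ≤ t)
    (h : ∀ x ∈ C, ∀ y ∈ C, Reach G w (fun u => u ∈ C) x y t) : strongDiam G w C ≤ t := by
  refine Real.iSup_le (fun q => ?_) ht
  obtain ⟨p, hp⟩ := exists_walk_of_reach (h _ q.1.2 _ q.2.2) (fun _ => id) q.1.2 q.2.2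
  exact (wdist_le (induce_weight_nonneg hw C) p).trans hp

theorem strongDiam_univ_le [Finite V] (hG : G.Connected) (hw : ∀ e ∈ G.edgeSet, 0 ≤ w e) :
    strongDiam G w univ ≤ wdiam G w := by
  refine Real.iSup_le (fun q => le_trans ?_ (wdist_le_wdiam q.1.1 q.2.1)) (wdiam_nonneg hw)
  have : Nonempty (G.Walk q.1.1 q.2.1) := hG.preconnected _ _
  refine le_ciInf fun p => ?_
  have hreach : ∀ {x y : V} (p : G.Walk x y), Reach G w (fun _ => True) x y (wlen w p) := by
    intro x y p
    induction p with
    | nil => exact .refl trivial (by simp [wlen])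
    | cons ha p ih => exact .step trivial ha ih (by simp [wlen])
  obtain ⟨p', hp'⟩ := exists_walk_of_reach (hreach p) (fun _ _ => mem_univ _) q.1.2 q.2.2
  exact (wdist_le (induce_weight_nonneg hw univ) p').trans hp'

/-- A single vertex already contains the clique minors for `r ≤ 1`. In those cases `r * log r`
vanishes and could not absorb the constants. -/
theorem two_le_of_cliqueMinorFree [Nonempty V] {r : ℕ} (h : CliqueMinorFree r G) : 2 ≤ r := by
  by_contra! hr
  obtain ⟨v⟩ := ‹Nonempty V›
  have hsub : ∀ i j : Fin r, i = j := fun i j => Fin.ext (by omega)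
  refine h ⟨fun _ => {v}, fun _ => ?_, fun i j hij => absurd (hsub i j) hij,
    fun i j hij => absurd (hsub i j) hij.ne⟩
  refine induce_connected_of_reach (w := fun _ => 0) ⟨v, rfl⟩ fun x hx y hy => ⟨0, ?_⟩
  rw [mem_singleton_iff.mp hx, mem_singleton_iff.mp hy]
  exact .refl rfl le_rfl

/-- The numerical estimate for the hop bound. -/
theorem hop_count_le {r : ℕ} (hr : 2 ≤ r) :
    (2 * (r + 1) * (2 * (r * (2 * r + 5) + 1) ^ (r + 1) - 2 + 1) : ℕ) ≤
      (2 : ℝ) ^ ((20 : ℝ) * ((r : ℝ) * Real.log r)) := by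
  -- The factors are bounded by `r ^ 3`, `r` and `(r ^ 5) ^ (r + 1)`, with total exponent `5 * r + 9
  -- ≤ 10 * r`.
  have h1 : 2 * (r + 1) * (2 * (r * (2 * r + 5) + 1) ^ (r + 1) - 2 + 1) ≤ r ^ (10 * r) := by
    have hM : r * (2 * r + 5) + 1 ≤ r ^ 5 := by
      have : 2 ^ 3 ≤ r ^ 3 := Nat.pow_le_pow_left hr 3
      calc r * (2 * r + 5) + 1 ≤ r ^ 2 * 2 ^ 3 := by nlinarith
        _ ≤ r ^ 2 * r ^ 3 := Nat.mul_le_mul_left _ this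
        _ = r ^ 5 := by ring
    have hpos : 1 ≤ (r * (2 * r + 5) + 1) ^ (r + 1) := Nat.one_le_pow _ _ (by omega)
    calc 2 * (r + 1) * (2 * (r * (2 * r + 5) + 1) ^ (r + 1) - 2 + 1)
        ≤ r ^ 3 * (r * (r ^ 5) ^ (r + 1)) := by
          refine Nat.mul_le_mul ?_ ?_
          · nlinarith [mul_self_nonneg r, Nat.mul_le_mul hr hr,
              Nat.mul_le_mul_right (r * r) hr, Nat.mul_le_mul_right r hr,
              show r ^ 3 = r * (r * r) by ring]
          · calc _ ≤ 2 * (r * (2 * r + 5) + 1) ^ (r + 1) := by omega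
              _ ≤ _ := Nat.mul_le_mul hr (Nat.pow_le_pow_left hM _)
      _ = r ^ (5 * r + 9) := by rw [← pow_mul]; ring
      _ ≤ r ^ (10 * r) := Nat.pow_le_pow_right (by omega) (by omega)
  have hr0 : (0 : ℝ) < r := by exact_mod_cast (by omega : 0 < r)
  have hlog : 0 ≤ Real.log r := Real.log_natCast_nonneg r
  calc ((2 * (r + 1) * (2 * (r * (2 * r + 5) + 1) ^ (r + 1) - 2 + 1) : ℕ) : ℝ)
      ≤ ((r ^ (10 * r) : ℕ) : ℝ) := by exact_mod_cast h1
    _ = Real.exp (10 * (r * Real.log r)) := by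
        rw [Nat.cast_pow, ← Real.rpow_natCast, Real.rpow_def_of_pos hr0]
        congr 1; push_cast; ring
    _ ≤ Real.exp (Real.log 2 * (20 * (r * Real.log r))) := by
        refine Real.exp_le_exp.mpr ?_
        -- Because `log 2 > 1 / 2`, doubling the constant `10` suffices for the change to base `2`.
        have h2 := Real.log_two_gt_d9
        have h3 : 0 ≤ (r : ℝ) * Real.log r := by positivity
        nlinarith
    _ = _ := (Real.rpow_def_of_pos two_pos _).symm

end Walks

/-! ### The shortcut partition. -/

section Main

variable {V : Type*} {G : SimpleGraph V} {w : Sym2 V → ℝ}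

/-- The partition into the fibres of a map. -/
def fibres {Λ : Type*} (g : V → Λ) : Set (Set V) := range fun v => {u | g u = g v}

/-- The fibre of a vertex. -/
def fibreOf {Λ : Type*} (g : V → Λ) (v : V) : fibres g := ⟨{u | g u = g v}, v, rfl⟩

theorem fibreOf_eq {Λ : Type*} {g : V → Λ} {v : V} {A : fibres g} (h : v ∈ A.1) :
    A = fibreOf g v := by
  obtain ⟨_, x, rfl⟩ := A
  have hvx : g v = g x := h
  exact Subtype.ext (by simp only [fibreOf, hvx])

theorem isPartition_fibres {Λ : Type*} (g : V → Λ) : Setoid.IsPartition (fibres g) := by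
  refine ⟨?_, fun v => ⟨{u | g u = g v}, ⟨⟨v, rfl⟩, rfl⟩, ?_⟩⟩
  · rintro ⟨v, hv⟩
    exact (hv.le (show v ∈ {u | g u = g v} from rfl) : v ∈ (∅ : Set V))
  · rintro _ ⟨⟨x, rfl⟩, hx⟩
    have hvx : g v = g x := hx
    simp only [hvx]

theorem exists_isShortcutPartition [Finite V] {r : ℕ} {ε : ℝ} (hG : G.Connected)
    (hw : ∀ e ∈ G.edgeSet, 0 ≤ w e) (hr : CliqueMinorFree r G) (hε : 0 < ε) :
    ∃ 𝒞, IsShortcutPartition G w ε ((2 : ℝ) ^ ((20 : ℝ) * ((r : ℝ) * Real.log r)) / ε) 𝒞 := by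
  classical
  have hne : Nonempty V := hG.nonempty
  have hw' : ∀ x y, G.Adj x y → 0 ≤ w s(x, y) := fun x y h => hw _ h
  have hεh : ε * ((2 : ℝ) ^ ((20 : ℝ) * ((r : ℝ) * Real.log r)) / ε) =
    (2 : ℝ) ^ ((20 : ℝ) * ((r : ℝ) * Real.log r)) := mul_div_cancel₀ _ hε.ne'
  -- At diameter zero `γ` would vanish; one single cluster meets every requirement.
  rcases (wdiam_nonneg hw).eq_or_lt with hD | hD
  · refine ⟨fibres fun _ : V => (), ⟨isPartition_fibres _, ?_⟩, ?_, ?_⟩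
    · rintro _ ⟨v, rfl⟩
      have hv : (fun v : V => {u : V | () = ()}) v = univ := eq_univ_of_forall fun _ => rfl
      rw [hv]
      exact (SimpleGraph.induceUnivIso G).connected_iff.mpr hG
    · rintro _ ⟨v, rfl⟩
      simpa [← hD] using strongDiam_univ_le hG hw
    · intro u v p _ A B hA hB
      have hAB : A = B := (fibreOf_eq hA).trans (fibreOf_eq hB).symm
      subst hAB
      refine ⟨.nil, by simp, ?_, fun C hC => ⟨u, by simp, ?_⟩⟩
      · rw [hεh, SimpleGraph.Walk.length_nil, Nat.cast_zero]; positivity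
      · rw [SimpleGraph.Walk.support_nil, List.mem_singleton] at hC
        exact hC ▸ hA
  -- Two vertices of a cluster are joined through its centre within `2 * γ * (1 + r)`, which this
  -- choice makes equal to `ε * wdiam G w`.
  set γ : ℝ := ε * wdiam G w / (2 * (r + 1)) with hγdef
  have hr1 : (0 : ℝ) < 2 * (r + 1) := by positivity
  have hγ : 0 < γ := by positivity
  have hγr : 2 * (r + 1) * γ = ε * wdiam G w := mul_div_cancel₀ _ hr1.ne'
  obtain ⟨s, f, K, hrad, hK, htop⟩ := exists_decomposition (r := r) (w := zeroWeight G w)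
    (zeroWeight_nonneg hw') hγ hr.zeroGraph
  set g : V → ZeroQuot G w := fun v => f (zeroProj G w v) with hg
  have hreach : ∀ x y, g x = g y →
      Reach G w (fun u => g u = g x) x y (ε * wdiam G w) := by
    intro x y hxy
    have hy := (hrad (zeroProj G w y)).symm
    simp only [hg] at hxy
    rw [← hxy] at hy
    exact (reach_of_zeroGraph ((hrad (zeroProj G w x)).trans hy) x y rfl rfl).mono
      (fun _ => id) (by rw [← hγr]; linarith)
  have htopG : ∀ Q : List V, Q ≠ [] → Q.IsChain G.Adj → chainLen w Q ≤ γ →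
      ∃ x ∈ Q, (∃ T : Set (ZeroQuot G w), T.ncard ≤ r * (2 * r + 5) ∧
        ∀ u ∈ Q, s (zeroProj G w u) = s (zeroProj G w x) → g u ∈ T) ∧
        ∀ u ∈ Q, s (zeroProj G w u) ≠ s (zeroProj G w x) →
          s (zeroProj G w x) ∈ K (s (zeroProj G w u)) := by
    intro Q hne hQ hle
    obtain ⟨v, l, rfl⟩ := List.exists_cons_of_ne_nil hne
    obtain ⟨l', h1, h2, h3⟩ := exists_zeroGraph_chain hw' l v hQ
    obtain ⟨z, hz, ⟨T, hT, hT'⟩, h4⟩ := htop _ (List.cons_ne_nil _ _) h1 (h2.trans hle)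
    obtain ⟨x, hx, rfl⟩ := (h3 z).mp hz
    exact ⟨x, hx, ⟨T, hT, fun u hu => hT' _ ((h3 _).mpr ⟨u, hu, rfl⟩)⟩,
      fun u hu => h4 _ ((h3 _).mpr ⟨u, hu, rfl⟩)⟩
  have hΓ : ∀ x y, G.Adj x y → fibreOf g x ≠ fibreOf g y →
      (clusterGraph G (fibres g)).Adj (fibreOf g x) (fibreOf g y) :=
    fun x y h hne => ⟨hne, x, rfl, y, rfl, h⟩
  have hshort : ∀ P : List V, P.IsChain G.Adj → chainLen w P ≤ γ →
      HasHops (clusterGraph G (fibres g)) (fibreOf g)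
        (2 * (r * (2 * r + 5) + 1) ^ (r + 1) - 2) P := fun P hP hle =>
    hasHops_of_top (f := g) (s := fun v => s (zeroProj G w v)) hw' hΓ
      (fun x y h => Subtype.ext (by simp only [fibreOf, h])) (fun v => hK _) htopG (r + 1) ∅ P
      (by simp) hP hle (by simp)
  refine ⟨fibres g, ⟨isPartition_fibres g, ?_⟩, ?_, ?_⟩
  · rintro _ ⟨v, rfl⟩
    refine induce_connected_of_reach (w := w) ⟨v, rfl⟩ fun x hx y hy =>
      ⟨_, (hreach x y (hx.trans hy.symm)).mono (fun u hu => hu.trans hx) le_rfl⟩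
  · rintro _ ⟨v, rfl⟩
    exact strongDiam_le hw (by positivity) fun x hx y hy =>
      (hreach x y (hx.trans hy.symm)).mono (fun u hu => hu.trans hx) le_rfl
  · intro u v p hp A B hA hB
    obtain rfl := fibreOf_eq hA
    obtain rfl := fibreOf_eq hB
    -- At distance zero the bound is `0`; the contraction has put `u` and `v` into the same cluster.
    rcases (wdist_nonneg hw u v).eq_or_lt with h0 | h0
    · have huv : fibreOf g u = fibreOf g v := Subtype.ext (by
        simp only [fibreOf, hg, zeroProj_eq_of_wlen_eq_zero hw' p (hp.2.trans h0.symm)])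
      refine ⟨SimpleGraph.Walk.nil.copy rfl huv, ?_, ?_, fun C hC => ⟨u, by simp, ?_⟩⟩
      · simp
      · rw [hεh, SimpleGraph.Walk.length_copy, SimpleGraph.Walk.length_nil, Nat.cast_zero]
        positivity
      · rw [SimpleGraph.Walk.support_copy, SimpleGraph.Walk.support_nil, List.mem_singleton] at hC
        exact hC ▸ hA
    · set n : ℕ := ⌈wdist G w u v / (ε * wdiam G w)⌉₊ with hn
      have hn0 : 0 < n := Nat.ceil_pos.mpr (by positivity)
      have hle : chainLen w p.support ≤ n * (2 * (r + 1) * γ) := by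
        rw [chainLen_support, hp.2, hγr, ← div_le_iff₀ (by positivity)]
        exact Nat.le_ceil _
      -- Each of the `n` units of length `ε * wdiam G w` accounts for `2 * (r + 1)` pieces of length
      -- `γ`.
      obtain ⟨k, hk⟩ : ∃ k, 2 * (r + 1) * n = k + 1 :=
        Nat.exists_eq_succ_of_ne_zero (by positivity)
      have hkr : (2 * (r + 1) * n : ℝ) = k + 1 := by exact_mod_cast hk
      obtain ⟨q, hq1, hq2⟩ := hasHops_of_short hγ.le hΓ hshort k p.support
        p.isChain_adj_support (hle.trans (by rw [← hkr]; apply le_of_eq; ring)) p.support_ne_nil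
      set q' := q.copy (congrArg (fibreOf g) p.head_support) (congrArg (fibreOf g) p.getLast_support)
        with hq'
      refine ⟨q'.bypass, q'.bypass_isPath, ?_, fun C hC => ?_⟩
      · have h1 : q'.bypass.length ≤
            (2 * (r + 1) * (2 * (r * (2 * r + 5) + 1) ^ (r + 1) - 2 + 1)) * n := by
          refine q'.length_bypass_le_length.trans ?_
          rw [hq', SimpleGraph.Walk.length_copy]
          refine hq1.trans (le_of_eq ?_)
          rw [← hk]; ring
        rw [hεh]
        calc (q'.bypass.length : ℝ) ≤
              ((2 * (r + 1) * (2 * (r * (2 * r + 5) + 1) ^ (r + 1) - 2 + 1) : ℕ) : ℝ) * n := by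
              exact_mod_cast h1
          _ ≤ _ := mul_le_mul_of_nonneg_right (hop_count_le (two_le_of_cliqueMinorFree hr))
              (Nat.cast_nonneg n)
      · have hC' := q'.support_bypass_subset_support hC
        rw [hq', SimpleGraph.Walk.support_copy] at hC'
        obtain ⟨x, hx, rfl⟩ := hq2 C hC'
        exact ⟨x, hx, rfl⟩

end Main

end ShortcutPartition

theorem theorem1 :
    ∃ c : ℝ, 0 < c ∧
      ∀ (r : ℕ) (V : Type*) [Finite V] (G : SimpleGraph V) (w : Sym2 V → ℝ) (ε : ℝ),
        G.Connected →
        (∀ e ∈ G.edgeSet, 0 ≤ w e) →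
        ShortcutPartition.CliqueMinorFree r G →
        0 < ε → ε < 1 →
        ∃ 𝒞 : Set (Set V),
          ShortcutPartition.IsShortcutPartition G w ε
            ((2 : ℝ) ^ (c * ((r : ℝ) * Real.log (r : ℝ))) / ε) 𝒞 :=
  ⟨20, by norm_num, fun _ _ _ _ _ _ hG hw hr hε _ =>
    ShortcutPartition.exists_isShortcutPartition hG hw hr hε⟩
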